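/- Let $\Sigma=\{a,b\}$ and let $f\colon\Sigma^*\to\Sigma^*$ be a nonerasing morphism (that is, $f(xy)=f(x)f(y)$ for all words $x,y$, and $f(a),f(b)$ are nonempty) that is prolongable on $a$, i.e. $f(a)=aw$ for some nonempty word $w$. Let $f^{\omega}(a)$ be the unique infinite word that has all the words $f^k(a)$, $k\ge 0$, as prefixes. Let $M_f$ be the $2\times 2$ matrix whose columns are indexed by the letters $a,b$ and whose column of a letter $x$ lists the numbers of occurrences of $a$ and of $b$ in $f(x)$; let $\theta_1,\theta_2$ be the eigenvalues of $M_f$, counted with algebraic multiplicity, with $|\theta_1|\ge|\theta_2|$. The morphism $f$ is primitive if all entries of some power $M_f^k$, $k\ge 1$, are positive. Two finite words $x,y$ are abelian equivalent, $x\sim_{ab}y$, if each letter occurs equally often in $x$ and in $y$. An infinite word $s=s_0s_1s_2\cdots$ is (eventually) abelian periodic if there are integers $r\ge 0$ and $p\ge 1$ such that $s_{r+kp}\cdots s_{r+(k+1)p-1}\sim_{ab}s_r\cdots s_{r+p-1}$ for all $k\ge 0$; it is (eventually) periodic if there are $r\ge 0$ and $p\ge 1$ with $s_{n+p}=s_n$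 for all $n\ge r$. A finite word is abelian periodic with period a nonempty word $P$ if it is a concatenation of one or more words, each abelian equivalent to $P$. Theorem. (i) If $f$ is primitive and $\theta_2\neq 0$, then $f^{\omega}(a)$ is abelian periodic if and only if $f(a)=a(ba)^k$ and $f(b)=b(ab)^m$ for some integers $k,m\ge 0$. (ii) If $f$ is primitive and $\theta_2=0$, then $f^{\omega}(a)$ is abelian periodic if and only if there exist an integer $K\ge 0$ and words $u,v,u',v'$ such that $f^K(a)=uv$, $f^K(b)=u'v'$, $u\sim_{ab}u'$, and the words $vu$ and $v'u'$ are abelian periodic with periods $P$ and $P'$, respectively, such that $P\sim_{ab}P'$. (iii) If $f$ is not primitive, then $f^{\omega}(a)$ is abelian periodic if and only if it is (eventually) periodic. -/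

import Mathlib

namespace AbelianPeriodicity

variable {α : Type*}

/-- A morphism of the free monoid of finite words: a map that preserves concatenation. -/
def IsMorphism (f : List α → List α) : Prop :=
  ∀ u v : List α, f (u ++ v) = f u ++ f v

/-- The image of each letter is a nonempty word. -/
def IsNonerasing (f : List α → List α) : Prop :=
  ∀ c : α, f [c] ≠ []

/-- `f` is prolongable on `a`: `f(a) = a u` for some nonempty word `u`. -/
def IsProlongable (f : List α → List α) (a : α) : Prop :=
  ∃ u : List α, u ≠ [] ∧ f [a] = a :: u

/-- The finite word `w` is a prefix of the infinite word `s`. -/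
def IsPrefixOf (w : List α) (s : ℕ → α) : Prop :=
  ∀ (i : ℕ) (h : i < w.length), w[i] = s i

/-- The infinite word `f^ω(a)`: its `n`-th letter is the `n`-th letter of `f^n(a)` (the default
value `a` is never used when `f` is a nonerasing morphism prolongable on `a`). -/
def omegaWord (f : List α → List α) (a : α) : ℕ → α :=
  fun n => (f^[n] [a]).getD n a

/-- The finite factor `s_i s_{i+1} ⋯ s_{i+n-1}` of an infinite word. -/
def factor (s : ℕ → α) (i n : ℕ) : List α :=
  (List.range n).map fun j => s (i + j)

/-- The power `w^k` of a finite word. -/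
def wordPow (w : List α) (k : ℕ) : List α :=
  (List.replicate k w).flatten

/-- An infinite word is periodic, a preperiod being allowed. -/
def IsEventuallyPeriodic (s : ℕ → α) : Prop :=
  ∃ r p : ℕ, 0 < p ∧ ∀ n : ℕ, r ≤ n → s (n + p) = s n

section Counting

variable [DecidableEq α]

/-- Two finite words are abelian equivalent: each letter occurs equally often in both. -/
def AbelianEquiv (u v : List α) : Prop :=
  ∀ c : α, u.count c = v.count c

/-- An infinite word is abelian periodic, with some preperiod `r` and some period `p ≥ 1`. -/
def IsEventuallyAbelianPeriodic (s : ℕ → α) : Prop :=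
  ∃ r p : ℕ, 0 < p ∧ ∀ k : ℕ, AbelianEquiv (factor s r p) (factor s (r + k * p) p)

/-- The finite word `w` is abelian periodic with the nonempty word `P` as a period (determined up
to abelian equivalence): `w` is a concatenation of one or more words abelian equivalent to `P`. -/
def HasAbelianPeriod (w P : List α) : Prop :=
  P ≠ [] ∧ ∃ L : List (List α), L ≠ [] ∧ (∀ x ∈ L, AbelianEquiv x P) ∧ w = L.flatten

/-- The matrix of `f`: the entry `(i, j)` is the number of occurrences of `i` in `f(j)`. -/
def morphismMatrix (f : List α → List α) : Matrix α α ℕ :=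
  Matrix.of fun i j => (f [j]).count i

/-- `f` is primitive: some power of its matrix has only positive entries. -/
def IsPrimitive [Fintype α] (f : List α → List α) : Prop :=
  ∃ k : ℕ, 0 < k ∧ ∀ i j : α, 0 < (morphismMatrix f ^ k) i j

end Counting

/-- `θ₁, θ₂` are the eigenvalues of the `2 × 2` matrix `M`, with algebraic multiplicity, in
non-increasing order of absolute value. -/
def AreOrderedEigenvalues (M : Matrix (Fin 2) (Fin 2) ℕ) (θ₁ θ₂ : ℂ) : Prop :=
  (M.map (fun n : ℕ => (n : ℂ))).charpoly.roots = {θ₁, θ₂} ∧ ‖θ₂‖ ≤ ‖θ₁‖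

theorem IsMorphism.map_nil {f : List α → List α} (hf : IsMorphism f) : f [] = [] := by
  have h := congrArg List.length (hf [] [])
  simp only [List.append_nil, List.length_append] at h
  exact List.length_eq_zero_iff.mp (by omega)

theorem IsMorphism.length_le {f : List α → List α} (hf : IsMorphism f) (hn : IsNonerasing f)
    (w : List α) : w.length ≤ (f w).length := by
  induction w with
  | nil => simp
  | cons c w ih =>
    have h : f (c :: w) = f [c] ++ f w := hf [c] w
    have h1 : 0 < (f [c]).length := List.length_pos_iff.mpr (hn c)
    rw [h, List.length_append, List.length_cons]
    omega

theorem IsMorphism.iterate {f : List α → List α} (hf : IsMorphism f) (k : ℕ) :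
    IsMorphism f^[k] := by
  induction k with
  | zero => intro u v; rfl
  | succ k ih =>
    intro u v
    rw [Function.iterate_succ_apply, Function.iterate_succ_apply, Function.iterate_succ_apply,
      hf, ih]

/-- `f^ω(a)` is the infinite word that has every `f^k(a)` as a prefix. -/
theorem omegaWord_unique {f : List α → List α} {a : α} (hf : IsMorphism f)
    (hn : IsNonerasing f) (hp : IsProlongable f a) (s : ℕ → α) :
    s = omegaWord f a ↔ ∀ k : ℕ, IsPrefixOf (f^[k] [a]) s := by
  obtain ⟨u, hu, hfa⟩ := hp
  have step : ∀ k, f^[k + 1] [a] = f^[k] [a] ++ f^[k] u := by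
    intro k
    rw [Function.iterate_succ_apply, hfa]
    exact hf.iterate k [a] u
  have hpos : ∀ k, 0 < (f^[k] u).length := by
    intro k
    induction k with
    | zero => exact List.length_pos_iff.mpr hu
    | succ k ih =>
      rw [Function.iterate_succ_apply']
      exact lt_of_lt_of_le ih (hf.length_le hn _)
  have hlen : ∀ k, k < (f^[k] [a]).length := by
    intro k
    induction k with
    | zero => simp
    | succ k ih =>
      rw [step, List.length_append]
      have := hpos k
      omega
  have hpre : ∀ j k, f^[j] [a] <+: f^[j + k] [a] := by
    intro j k
    induction k with
    | zero => exact List.prefix_refl _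
    | succ k ih =>
      refine ih.trans ?_
      rw [← add_assoc, step]
      exact List.prefix_append _ _
  have hpre' : ∀ j k, j ≤ k → f^[j] [a] <+: f^[k] [a] := by
    intro j k h
    obtain ⟨d, rfl⟩ := Nat.exists_eq_add_of_le h
    exact hpre j d
  constructor
  · rintro rfl k i hi
    have h1 : omegaWord f a i = (f^[i] [a])[i]'(hlen i) := by
      exact List.getD_eq_getElem _ _ (hlen i)
    rw [h1]
    rcases le_total i k with h | h
    · exact ((hpre' i k h).getElem (hlen i)).symm
    · exact (hpre' k i h).getElem hi
  · intro h
    funext n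
    rw [← h n n (hlen n)]
    exact (List.getD_eq_getElem _ _ (hlen n)).symm

end AbelianPeriodicity

/-! Let an abelian period of the fixed point `s` contain `A` zeros and `B` ones, and give `0` the
weight `B` and `1` the weight `-A`. Periods weigh zero, so prefix weights are bounded. Since `f`
maps prefixes of `s` to prefixes, the weights of their images cannot grow linearly, which makes the
weights of `f [0]`, `f [1]` orthogonal to `(A, B)` (`image_weight_orthogonal`). Hence `f` multiplies
weights by a constant `lam`, an integer once the weights are made coprime.

If `lam ≠ 0`, comparing maximal and minimal prefix weights gives `lam = 1` (`eigenvalue_eq_one`).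
Images of letters placed at extremal prefixes are then confined to a narrow strip, which dictates
their letters (`image_shape`), and `s` turns out to be `0www⋯`. This settles two cases: for `θ₂ ≠
0`, `lam = 0` would make the matrix singular; for non-primitive `f`, one image is a power of a
single letter and has nonzero weight, unless a letter is missing from the period and `s` is
eventually constant.

If `θ₂ = 0` and `f` is primitive, every image weighs zero, so the prefix weight at a position of `s`
depends only on the place inside the current block `F [c]`, where `F` is a power of `f`. For a
suitable power, the blocks of each letter start at enough residues modulo the period `p`
(`exists_addSubgroup_residues`) that every place congruent to `r` modulo `gcd(p, |F(0)|, |F(1)|)`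
occurs at a position congruent to `r` modulo `p`. All these places thus carry the same weight, and
cutting both blocks there gives the conjugate periods (`exists_conjugate_periods`). Conversely, such
cuts give equal prefix weights at equally spaced positions of `s` (`abelianPeriodic_of_blocks`). -/

namespace AbelianPeriodicity

/-! ### Factors of infinite words -/

section Factor

variable {α : Type*}

@[simp] theorem length_factor (s : ℕ → α) (i n : ℕ) : (factor s i n).length = n := by
  simp [factor]

@[simp] theorem factor_zero (s : ℕ → α) (i : ℕ) : factor s i 0 = [] := rfl

theorem factor_add (s : ℕ → α) (i m n : ℕ) :
    factor s i (m + n) = factor s i m ++ factor s (i + m) n := by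
  simp [factor, List.range_add, Function.comp_def, add_assoc]

theorem factor_succ (s : ℕ → α) (i n : ℕ) :
    factor s i (n + 1) = factor s i n ++ [s (i + n)] := by
  rw [factor_add]
  simp [factor]

theorem take_factor (s : ℕ → α) (i : ℕ) {m n : ℕ} (h : n ≤ m) :
    (factor s i m).take n = factor s i n := by
  obtain ⟨d, rfl⟩ := Nat.exists_eq_add_of_le h
  rw [factor_add, List.take_append_of_le_length (by simp), List.take_of_length_le (by simp)]

theorem eq_factor_of_prefix {s : ℕ → α} {w : List α} {n : ℕ} (h : w <+: factor s 0 n) :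
    w = factor s 0 w.length := by
  have hl := h.length_le
  rw [length_factor] at hl
  rw [List.prefix_iff_eq_take] at h
  rw [take_factor s 0 hl] at h
  exact h

theorem IsPrefixOf.eq_factor {s : ℕ → α} {w : List α} (h : IsPrefixOf w s) :
    w = factor s 0 w.length := by
  apply List.ext_getElem (by simp)
  intro i h1 h2
  simp [factor, h i h1]

theorem isPrefixOf_factor (s : ℕ → α) (n : ℕ) : IsPrefixOf (factor s 0 n) s := by
  intro i h
  simp [factor]

/-- The images under `F` of the prefixes of `s` are prefixes of `s`, that is, `F(s) = s`. -/
def Fixes (F : List α → List α) (s : ℕ → α) : Prop :=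
  ∀ n, F (factor s 0 n) = factor s 0 (F (factor s 0 n)).length

theorem Fixes.iterate {F : List α → List α} {s : ℕ → α} (h : Fixes F s) (k : ℕ) :
    Fixes F^[k] s := by
  induction k with
  | zero => intro n; simp
  | succ k ih =>
    intro n
    rw [Function.iterate_succ_apply, h n]
    exact ih _

theorem Fixes.factor_add {F : List α → List α} {s : ℕ → α} (hF : IsMorphism F)
    (h : Fixes F s) (n : ℕ) {j : ℕ} (hj : j ≤ (F [s n]).length) :
    factor s 0 ((F (factor s 0 n)).length + j) = F (factor s 0 n) ++ (F [s n]).take j := by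
  have h1 := h (n + 1)
  rw [factor_succ, hF, zero_add] at h1
  have h2 := congrArg (List.take ((F (factor s 0 n)).length + j)) h1
  rw [take_factor _ _ (by simp [hj])] at h2
  rw [← h2, List.take_append, List.take_of_length_le (by omega)]
  simp

theorem lt_length_iterate {f : List α → List α} {a : α} (hf : IsMorphism f)
    (hn : IsNonerasing f) (hp : IsProlongable f a) (k : ℕ) : k < (f^[k] [a]).length := by
  obtain ⟨u, hu, hfa⟩ := hp
  have hpos : ∀ k, 0 < (f^[k] u).length := by
    intro k
    induction k with
    | zero => exact List.length_pos_iff.mpr hu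
    | succ k ih =>
      rw [Function.iterate_succ_apply']
      exact lt_of_lt_of_le ih (hf.length_le hn _)
  induction k with
  | zero => simp
  | succ k ih =>
    have hstep : f^[k + 1] [a] = f^[k] [a] ++ f^[k] u := by
      rw [Function.iterate_succ_apply, hfa]
      exact hf.iterate k [a] u
    rw [hstep, List.length_append]
    have := hpos k
    omega

theorem fixes_omegaWord {f : List α → List α} {a : α} (hf : IsMorphism f)
    (hn : IsNonerasing f) (hp : IsProlongable f a) : Fixes f (omegaWord f a) := by
  have hpre := (omegaWord_unique hf hn hp (omegaWord f a)).1 rfl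
  intro n
  have h1 := (hpre n).eq_factor
  have h2 := (hpre (n + 1)).eq_factor
  rw [Function.iterate_succ_apply', h1] at h2
  obtain ⟨d, hd⟩ := Nat.exists_eq_add_of_le (lt_length_iterate hf hn hp n).le
  rw [hd, AbelianPeriodicity.factor_add, hf] at h2
  exact eq_factor_of_prefix ⟨_, h2⟩

theorem Fixes.getElem {F : List α → List α} {s : ℕ → α} (hF : IsMorphism F)
    (h : Fixes F s) (n : ℕ) {j : ℕ} (hj : j < (F [s n]).length) :
    s ((F (factor s 0 n)).length + j) = (F [s n])[j] := by
  have h1 := h (n + 1)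
  have h2 := isPrefixOf_factor s (F (factor s 0 (n + 1))).length
  rw [← h1, factor_succ, hF, zero_add] at h2
  rw [← h2 _ (by simpa using hj), List.getElem_append_right (by omega)]
  simp

theorem Fixes.exists_block {F : List α → List α} {s : ℕ → α} (hF : IsMorphism F)
    (hn : IsNonerasing F) (n : ℕ) :
    ∃ i j, j < (F [s i]).length ∧ n = (F (factor s 0 i)).length + j := by
  induction n with
  | zero => exact ⟨0, 0, List.length_pos_iff.2 (hn _), by simp [hF.map_nil]⟩
  | succ n ih =>
    obtain ⟨i, j, hj, rfl⟩ := ih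
    by_cases h : j + 1 < (F [s i]).length
    · exact ⟨i, j + 1, h, rfl⟩
    · refine ⟨i + 1, 0, List.length_pos_iff.2 (hn _), ?_⟩
      rw [factor_succ, hF, List.length_append, zero_add]
      omega

theorem IsNonerasing.iterate {f : List α → List α} (hf : IsMorphism f) (hn : IsNonerasing f)
    (k : ℕ) : IsNonerasing f^[k] := by
  induction k with
  | zero => intro c; simp
  | succ k ih =>
    intro c h
    rw [Function.iterate_succ_apply'] at h
    have h1 := hf.length_le hn (f^[k] [c])
    rw [h] at h1
    exact ih c (List.length_eq_zero_iff.1 (by simpa using h1))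

end Factor

/-! ### Weights of binary words -/

theorem count_zero_add_count_one (w : List (Fin 2)) : w.count 0 + w.count 1 = w.length := by
  induction w with
  | nil => rfl
  | cons c w ih =>
    fin_cases c <;> simp <;> omega

theorem additive_eq {R : Type*} [AddCommMonoid R] (φ : List (Fin 2) → R) (h0 : φ [] = 0)
    (h : ∀ u v, φ (u ++ v) = φ u + φ v) (w : List (Fin 2)) :
    φ w = w.count 0 • φ [0] + w.count 1 • φ [1] := by
  induction w with
  | nil => simp [h0]
  | cons c w ih =>
    have h1 : φ (c :: w) = φ [c] + φ w := h [c] w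
    rw [h1, ih]
    fin_cases c
    · simp [succ_nsmul']; abel
    · simp [succ_nsmul']; abel

/-- The additive weight in which the letter `0` counts `q` and the letter `1` counts `-r`. -/
def weight (q r : ℤ) (w : List (Fin 2)) : ℤ := q * w.count 0 - r * w.count 1

@[simp] theorem weight_nil (q r : ℤ) : weight q r [] = 0 := by simp [weight]

theorem weight_append (q r : ℤ) (u v : List (Fin 2)) :
    weight q r (u ++ v) = weight q r u + weight q r v := by
  simp [weight]; ring

@[simp] theorem weight_zero (q r : ℤ) : weight q r [0] = q := by simp [weight]

@[simp] theorem weight_one (q r : ℤ) : weight q r [1] = -r := by simp [weight]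

theorem weight_image (q r : ℤ) {f : List (Fin 2) → List (Fin 2)} (hf : IsMorphism f)
    (w : List (Fin 2)) : weight q r (f w) =
      w.count 0 * weight q r (f [0]) + w.count 1 * weight q r (f [1]) := by
  have := additive_eq (fun w => weight q r (f w)) (by simp [hf.map_nil])
    (fun u v => by simp only [hf u v, weight_append]) w
  simpa using this

theorem length_image {f : List (Fin 2) → List (Fin 2)} (hf : IsMorphism f)
    (w : List (Fin 2)) : (f w).length =
      w.count 0 * (f [0]).length + w.count 1 * (f [1]).length := by
  have := additive_eq (fun w => (f w).length) (by simp [hf.map_nil])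
    (fun u v => by simp only [hf u v, List.length_append]) w
  simpa using this

theorem AbelianEquiv.length_eq {u v : List (Fin 2)} (h : AbelianEquiv u v) :
    u.length = v.length := by
  rw [← count_zero_add_count_one, ← count_zero_add_count_one v, h 0, h 1]

theorem AbelianEquiv.weight_eq {u v : List (Fin 2)} (h : AbelianEquiv u v) (q r : ℤ) :
    weight q r u = weight q r v := by
  simp [weight, h 0, h 1]

/-- Since `q + r ≠ 0`, length and weight are independent linear forms in the two letter counts. -/
theorem abelianEquiv_of_weight_eq {q r : ℤ} (hqr : 0 < q + r) {u v : List (Fin 2)}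
    (hl : u.length = v.length) (h : weight q r u = weight q r v) : AbelianEquiv u v := by
  rw [← count_zero_add_count_one, ← count_zero_add_count_one v] at hl
  have hl' : (u.count 0 : ℤ) + u.count 1 = v.count 0 + v.count 1 := by exact_mod_cast hl
  unfold weight at h
  have h0 : (q + r) * ((u.count 0 : ℤ) - v.count 0) = 0 := by linear_combination h + r * hl'
  have h1 : (u.count 0 : ℤ) - v.count 0 = 0 := (mul_eq_zero.1 h0).resolve_left hqr.ne'
  intro c
  fin_cases c
  · simp; omega
  · simp; omega

theorem weight_self_counts (w : List (Fin 2)) : weight (w.count 1) (w.count 0) w = 0 := by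
  simp [weight]; ring

/-- In an abelian periodic word, the prefixes that end at a period boundary have the same
weight. -/
theorem weight_factor_of_abelianPeriodic {s : ℕ → Fin 2} {r p : ℕ}
    (h : ∀ k : ℕ, AbelianEquiv (factor s r p) (factor s (r + k * p) p)) {x y : ℤ}
    (hxy : weight x y (factor s r p) = 0) (k : ℕ) :
    weight x y (factor s 0 (r + k * p)) = weight x y (factor s 0 r) := by
  induction k with
  | zero => simp
  | succ k ih =>
    rw [show r + (k + 1) * p = (r + k * p) + p by ring, factor_add, weight_append, ih, zero_add,
      ← (h k).weight_eq, hxy, add_zero]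

theorem weight_factor_add_le {s : ℕ → Fin 2} (q r : ℕ) (i n : ℕ) :
    |weight q r (factor s i n)| ≤ (q + r) * n := by
  have h := count_zero_add_count_one (factor s i n)
  rw [length_factor] at h
  have h' : ((factor s i n).count 0 : ℤ) + (factor s i n).count 1 = n := by exact_mod_cast h
  rw [abs_le, ← h', weight]
  have h00 : (0 : ℤ) ≤ q * (factor s i n).count 0 := by positivity
  have h01 : (0 : ℤ) ≤ q * (factor s i n).count 1 := by positivity
  have h10 : (0 : ℤ) ≤ r * (factor s i n).count 0 := by positivity
  have h11 : (0 : ℤ) ≤ r * (factor s i n).count 1 := by positivity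
  constructor <;> linarith

theorem weight_factor_bounded {s : ℕ → Fin 2} {r p : ℕ} (hp : 0 < p)
    (h : ∀ k : ℕ, AbelianEquiv (factor s r p) (factor s (r + k * p) p)) {x y : ℕ}
    (hxy : weight x y (factor s r p) = 0) :
    ∃ C : ℤ, ∀ n, |weight x y (factor s 0 n)| ≤ C := by
  -- Only the preperiod and one incomplete period contribute: at most `r + p` letters, each of
  -- absolute weight at most `x + y`.
  refine ⟨(x + y) * (r + p), fun n => ?_⟩
  have hxy0 : (0 : ℤ) ≤ x + y := by positivity
  by_cases hn : n < r
  · refine (weight_factor_add_le x y 0 n).trans (mul_le_mul_of_nonneg_left ?_ hxy0)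
    exact_mod_cast (by omega : n ≤ r + p)
  · have h1 : n = (r + (n - r) / p * p) + (n - r) % p := by
      have := Nat.div_add_mod' (n - r) p
      omega
    rw [h1, factor_add, weight_append, weight_factor_of_abelianPeriodic h hxy]
    refine (abs_add_le _ _).trans ?_
    have h2 := weight_factor_add_le (s := s) x y 0 r
    have h3 := weight_factor_add_le (s := s) x y (0 + (r + (n - r) / p * p)) ((n - r) % p)
    have h4 : (x + y : ℤ) * ((n - r) % p : ℕ) ≤ (x + y) * p :=
      mul_le_mul_of_nonneg_left (by exact_mod_cast (Nat.mod_lt _ hp).le) hxy0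
    linarith

/-- The weights of the images of the two letters are orthogonal to the letter counts of an
abelian period. -/
theorem image_weight_orthogonal {f : List (Fin 2) → List (Fin 2)} (hf : IsMorphism f)
    {s : ℕ → Fin 2} (hfix : Fixes f s) {r p : ℕ}
    (h : ∀ k : ℕ, AbelianEquiv (factor s r p) (factor s (r + k * p) p)) {x y : ℤ} {C : ℤ}
    (hC : ∀ n, |weight x y (factor s 0 n)| ≤ C) :
    (factor s r p).count 0 * weight x y (f [0]) + (factor s r p).count 1 * weight x y (f [1])
      = 0 := by
  set e := ((factor s r p).count 0 : ℤ) * weight x y (f [0]) +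
    (factor s r p).count 1 * weight x y (f [1]) with he
  have key : ∀ k : ℕ, weight x y (f (factor s 0 (r + k * p))) =
      weight x y (f (factor s 0 r)) + k * e := by
    intro k
    induction k with
    | zero => simp
    | succ k ih =>
      rw [show r + (k + 1) * p = (r + k * p) + p by ring, factor_add, hf, weight_append, ih,
        zero_add, weight_image x y hf (factor s (r + k * p) p), ← h k 0, ← h k 1, ← he]
      push_cast
      ring
  by_contra hne
  have hb : ∀ n, |weight x y (f (factor s 0 n))| ≤ C := fun n => by rw [hfix n]; exact hC _
  have h0 := hb r
  -- Two values bounded by `C` differ by at most `2 * C`, so `2 * C + 1` periods refute a nonzero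
  -- slope `e`.
  have h1 := hb (r + (2 * C.toNat + 1) * p)
  rw [key] at h1
  have hC0 : (C.toNat : ℤ) = C := Int.toNat_of_nonneg ((abs_nonneg _).trans h0)
  have h3 : |((2 * C.toNat + 1 : ℕ) : ℤ) * e| ≤ 2 * C := by
    rw [abs_le] at *
    constructor <;> linarith
  rw [abs_mul] at h3
  have h4 : 1 ≤ |e| := Int.one_le_abs hne
  push_cast at h3
  rw [hC0, abs_of_nonneg (by linarith [abs_nonneg (weight x y (f (factor s 0 r)))])] at h3
  nlinarith [abs_nonneg (weight x y (f (factor s 0 r)))]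

/-! ### Powers of words and weight paths confined to a strip -/

theorem wordPow_succ {α : Type*} (w : List α) (k : ℕ) : wordPow w (k + 1) = w ++ wordPow w k := by
  simp [wordPow, List.replicate_succ]

@[simp] theorem wordPow_zero {α : Type*} (w : List α) : wordPow w 0 = [] := rfl

theorem wordPow_add {α : Type*} (w : List α) (k l : ℕ) :
    wordPow w (k + l) = wordPow w k ++ wordPow w l := by
  rw [wordPow, List.replicate_add, List.flatten_append]; rfl

theorem weight_cons_zero (q r : ℤ) (w : List (Fin 2)) :
    weight q r (0 :: w) = q + weight q r w := by
  simp [weight]; ring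

theorem weight_cons_one (q r : ℤ) (w : List (Fin 2)) :
    weight q r (1 :: w) = -r + weight q r w := by
  simp [weight]; ring

theorem forall_take_cons {q r : ℤ} {x : ℤ} {c : Fin 2} {w : List (Fin 2)} {P : ℤ → Prop}
    (h : ∀ j, P (x + weight q r ((c :: w).take j))) (j : ℕ) :
    P ((x + weight q r [c]) + weight q r (w.take j)) := by
  have := h (j + 1)
  rw [List.take_succ_cons, ← List.singleton_append, weight_append, ← add_assoc] at this
  exact this

/-- A word whose partial weights stay in `[0, q]` and which ends at `q` starts by coming down
to `0` in steps of size `r`. -/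
theorem dvd_of_path {q r : ℤ} (hr : 0 < r) (w : List (Fin 2)) :
    ∀ x : ℤ, w ≠ [] → (∀ j, 0 ≤ x + weight q r (w.take j) ∧ x + weight q r (w.take j) ≤ q) →
      x + weight q r w = q → r ∣ x := by
  induction w with
  | nil => intro x h; exact absurd rfl h
  | cons c w ih =>
    intro x _ h hx
    have h0 := h 0
    have h1 := h 1
    have h2 := forall_take_cons (P := fun z => 0 ≤ z ∧ z ≤ q) h
    fin_cases c
    · simp at h0 h1
      have : x = 0 := by omega
      simp [this]
    · simp at h0 h1 h2
      by_cases hw : w = []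
      · subst hw
        simp at hx
        omega
      · have := ih (x + -r) hw h2 (by refine .trans ?_ hx; simp [weight_cons_one]; ring)
        simpa using dvd_add this dvd_rfl

/-- In the strip `[0, q]` a rise by `q` is possible only from height `0` and a descent only from
above it, so the height forces each letter. -/
theorem eq_of_path {q : ℕ} (w : List (Fin 2)) :
    ∀ x : ℕ, w ≠ [] → (∀ j, 0 ≤ (x : ℤ) + weight q 1 (w.take j) ∧
      (x : ℤ) + weight q 1 (w.take j) ≤ q) →
      (x : ℤ) + weight q 1 w = q →
      ∃ k, w = List.replicate x 1 ++ 0 :: wordPow (List.replicate q 1 ++ [0]) k := by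
  induction w with
  | nil => intro x h; exact absurd rfl h
  | cons c w ih =>
    intro x _ h hx
    have h0 := h 0
    have h1 := h 1
    have h2 := forall_take_cons (P := fun z => 0 ≤ z ∧ z ≤ (q : ℤ)) h
    fin_cases c
    · simp at h0 h1 h2
      have hx0 : x = 0 := by omega
      subst hx0
      by_cases hw : w = []
      · exact ⟨0, by simp [hw]⟩
      · obtain ⟨k, hk⟩ := ih q hw (by simpa using h2)
          (by refine .trans ?_ hx; simp [weight_cons_zero])
        refine ⟨k + 1, ?_⟩
        rw [wordPow_succ, hk]
        simp
    · simp at h0 h1 h2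
      have hx0 : 1 ≤ x := by omega
      obtain ⟨y, rfl⟩ := Nat.exists_eq_add_of_le' hx0
      by_cases hw : w = []
      · subst hw
        simp at hx
        omega
      · obtain ⟨k, hk⟩ := ih y hw (by
          intro j
          have := h2 j
          push_cast at this
          constructor <;> linarith [this.1, this.2])
          (by refine .trans ?_ hx; simp [weight_cons_one])
        refine ⟨k, ?_⟩
        simp [hk, List.replicate_succ]

/-- In a strip of height one each level allows a single letter. The statements for the two starting
levels feed each other in the induction. -/
theorem eq_alternating_of_path (w : List (Fin 2)) :
    ((∀ j, -1 ≤ weight 1 1 (w.take j) ∧ weight 1 1 (w.take j) ≤ 0) → weight 1 1 w = -1 →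
      ∃ m, w = 1 :: wordPow [0, 1] m) ∧
    ((∀ j, -1 ≤ -1 + weight 1 1 (w.take j) ∧ -1 + weight 1 1 (w.take j) ≤ 0) →
      weight 1 1 w = 0 → ∃ m, w = wordPow [0, 1] m) := by
  induction w with
  | nil => simp; exact ⟨0, rfl⟩
  | cons c w ih =>
    constructor
    · intro h hw
      have h1 := h 1
      have h2 := forall_take_cons (P := fun z => -1 ≤ z ∧ z ≤ 0) (x := 0) (by simpa using h)
      fin_cases c
      · simp at h1
      · obtain ⟨m, hm⟩ := ih.2 (by simpa using h2) (by
          simp [weight_cons_one] at hw; exact hw)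
        exact ⟨m, by simp [hm]⟩
    · intro h hw
      have h1 := h 1
      have h2 := forall_take_cons (P := fun z => -1 ≤ z ∧ z ≤ 0) h
      fin_cases c
      · obtain ⟨m, hm⟩ := ih.1 (by simpa using h2) (by
          simp [weight_cons_zero] at hw; linarith)
        exact ⟨m + 1, by simp [hm, wordPow_succ]⟩
      · simp at h1

/-- A step from a weight at least `-1` up to a weight at most `0` has size at most one. -/
theorem le_one_of_mem_of_path {q r : ℤ} {w : List (Fin 2)} (hmem : (0 : Fin 2) ∈ w)
    (h : ∀ j, -1 ≤ weight q r (w.take j) ∧ weight q r (w.take j) ≤ 0) : q ≤ 1 := by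
  obtain ⟨u, v, rfl⟩ := List.append_of_mem hmem
  have h1 := (h u.length).1
  have h2 := (h (u.length + 1)).2
  rw [List.take_left] at h1
  rw [List.take_length_add_append, weight_append] at h2
  simp at h2
  linarith

theorem weight_image_eq {q r lam : ℤ} {f : List (Fin 2) → List (Fin 2)} (hf : IsMorphism f)
    (hx : weight q r (f [0]) = lam * q) (hy : weight q r (f [1]) = -(lam * r))
    (w : List (Fin 2)) : weight q r (f w) = lam * weight q r w := by
  rw [weight_image q r hf, hx, hy, weight]
  ring

/-! ### Extremal prefix weights of a fixed point -/

section Extremal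

variable {f : List (Fin 2) → List (Fin 2)} {s : ℕ → Fin 2} {q r : ℕ} {C lam : ℤ}

theorem exists_max_weight (hC : ∀ n, |weight q r (factor s 0 n)| ≤ C) :
    ∃ n, ∀ m, weight q r (factor s 0 m) ≤ weight q r (factor s 0 n) := by
  obtain ⟨z, ⟨n, rfl⟩, hz⟩ := Int.exists_greatest_of_bdd
    (P := fun z => ∃ n, weight q r (factor s 0 n) = z)
    ⟨C, fun z ⟨n, hn⟩ => hn ▸ (le_abs_self _).trans (hC n)⟩ ⟨_, 0, rfl⟩
  exact ⟨n, fun m => hz _ ⟨m, rfl⟩⟩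

theorem exists_min_weight (hC : ∀ n, |weight q r (factor s 0 n)| ≤ C) :
    ∃ n, ∀ m, weight q r (factor s 0 n) ≤ weight q r (factor s 0 m) := by
  obtain ⟨z, ⟨n, rfl⟩, hz⟩ := Int.exists_least_of_bdd
    (P := fun z => ∃ n, weight q r (factor s 0 n) = z)
    ⟨-C, fun z ⟨n, hn⟩ => hn ▸ (abs_le.1 (hC n)).1⟩ ⟨_, 0, rfl⟩
  exact ⟨n, fun m => hz _ ⟨m, rfl⟩⟩

theorem weight_factor_succ (s : ℕ → Fin 2) (q r : ℤ) (n : ℕ) :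
    (s n = 0 ∧ weight q r (factor s 0 (n + 1)) = weight q r (factor s 0 n) + q) ∨
    (s n = 1 ∧ weight q r (factor s 0 (n + 1)) = weight q r (factor s 0 n) - r) := by
  rw [factor_succ, weight_append, zero_add]
  have : s n = 0 ∨ s n = 1 := by omega
  rcases this with h | h
  · exact Or.inl ⟨h, by simp [h]⟩
  · exact Or.inr ⟨h, by simp [h]; ring⟩

/-- The weight inside the image of a letter of a fixed point. -/
theorem weight_in_block (hf : IsMorphism f) (hfix : Fixes f s)
    (hx : weight q r (f [0]) = lam * q) (hy : weight q r (f [1]) = -(lam * r)) (n j : ℕ) :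
    ∃ m, weight q r (factor s 0 m) =
      lam * weight q r (factor s 0 n) + weight q r ((f [s n]).take j) := by
  refine ⟨(f (factor s 0 n)).length + min j (f [s n]).length, ?_⟩
  rw [hfix.factor_add hf n (min_le_right _ _), weight_append, weight_image_eq hf hx hy]
  rw [← List.take_eq_take_min]

/-- Let `D > 0` and `E ≤ 0` be the extremal prefix weights; `lam * D` and `lam * E` are prefix
weights too. If `lam ≥ 2`, then `lam * D` exceeds `D`. If `lam < 0`, then `lam * D ≥ E` gives `lam *
E ≥ D`, and the letter `0` opening the image of the `0` that follows the minimum lifts the weight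
above `D`. -/
theorem eigenvalue_eq_one (hf : IsMorphism f) (hfix : Fixes f s) (h0 : s 0 = 0)
    {u : List (Fin 2)} (hfa : f [0] = 0 :: u) (hq : 0 < q) (hr : 0 < r)
    (hC : ∀ n, |weight q r (factor s 0 n)| ≤ C)
    (hx : weight q r (f [0]) = lam * q) (hy : weight q r (f [1]) = -(lam * r))
    (hlam : lam ≠ 0) : lam = 1 := by
  obtain ⟨N, hN⟩ := exists_max_weight hC
  obtain ⟨N', hN'⟩ := exists_min_weight hC
  have hq' : (0 : ℤ) < q := by exact_mod_cast hq
  have hr' : (0 : ℤ) < r := by exact_mod_cast hr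
  have hmax : (q : ℤ) ≤ weight q r (factor s 0 N) := by
    have := hN 1
    simpa [factor, h0] using this
  have hmin : s N' = 0 := by
    rcases weight_factor_succ s q r N' with h | h
    · exact h.1
    · have := hN' (N' + 1)
      linarith [h.2]
  obtain ⟨m1, hm1⟩ := weight_in_block hf hfix hx hy N 0
  obtain ⟨m2, hm2⟩ := weight_in_block hf hfix hx hy N' 0
  obtain ⟨m3, hm3⟩ := weight_in_block hf hfix hx hy N' 1
  rw [hmin, hfa] at hm3
  simp at hm1 hm2 hm3
  have a1 := hN m1
  have a2 := hN m2
  have a3 := hN m3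
  have b1 := hN' m1
  have b2 := hN' m2
  have hz := hN' 0
  simp at hz
  set D := weight q r (factor s 0 N)
  set E := weight q r (factor s 0 N')
  rw [hm1] at a1 b1
  rw [hm2] at a2 b2
  rw [hm3] at a3
  rcases lt_trichotomy lam 0 with h | h | h
  · nlinarith
  · exact absurd h hlam
  · by_contra hne
    have : 2 ≤ lam := by omega
    nlinarith

/-- The maximum is entered by a `0` and the minimum is left by a `0`, so the path of `f [0]` stays
in `[0, q]`; this forces `r ∣ q`, hence `r = 1`, and then the letters. Likewise the maximum is left
by a `1` and the minimum is entered by a `1`, so the path of `f [1]` stays in `[-1, 0]`, where a `0`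
fits only if `q = 1`. -/
theorem image_shape (hf : IsMorphism f) (hfix : Fixes f s) (h0 : s 0 = 0)
    {u : List (Fin 2)} (hu : u ≠ []) (hfa : f [0] = 0 :: u) (hq : 0 < q) (hr : 0 < r)
    (hcop : q.Coprime r)
    (hC : ∀ n, |weight q r (factor s 0 n)| ≤ C)
    (hx : weight q r (f [0]) = q) (hy : weight q r (f [1]) = -r) :
    (∃ k, f [0] = 0 :: wordPow (List.replicate q 1 ++ [0]) k) ∧
    ((0 : Fin 2) ∈ f [1] → q = 1 ∧ ∃ m, f [1] = 1 :: wordPow [0, 1] m) := by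
  have hq' : (0 : ℤ) < q := by exact_mod_cast hq
  have hr' : (0 : ℤ) < r := by exact_mod_cast hr
  obtain ⟨N, hN⟩ := exists_max_weight hC
  obtain ⟨N', hN'⟩ := exists_min_weight hC
  have hblock := weight_in_block (lam := 1) hf hfix (by rw [hx, one_mul]) (by rw [hy, one_mul])
  have hmax : (q : ℤ) ≤ weight q r (factor s 0 N) := by
    have := hN 1
    simpa [factor, h0] using this
  have hmin : s N' = 0 := by
    rcases weight_factor_succ s q r N' with h | h
    · exact h.1
    · have := hN' (N' + 1)
      linarith [h.2]
  obtain ⟨M, rfl⟩ : ∃ M, N = M + 1 := by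
    cases N with
    | zero => simp at hmax; omega
    | succ M => exact ⟨M, rfl⟩
  have hM : s M = 0 ∧ weight q r (factor s 0 (M + 1)) = weight q r (factor s 0 M) + q := by
    rcases weight_factor_succ s q r M with h | h
    · exact h
    · have := hN M
      linarith [h.2]
  have hN1 : s (M + 1) = 1 := by
    rcases weight_factor_succ s q r (M + 1) with h | h
    · have := hN (M + 1 + 1)
      linarith [h.2]
    · exact h.1
  have hpath : ∀ j, 0 ≤ weight q r ((f [0]).take j) ∧ weight q r ((f [0]).take j) ≤ q := by
    intro j
    obtain ⟨m1, hm1⟩ := hblock M j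
    obtain ⟨m2, hm2⟩ := hblock N' j
    have a1 := hN m1
    have a2 := hN' m2
    rw [hm1, hM.1] at a1
    rw [hm2, hmin] at a2
    constructor <;> linarith [hM.2]
  have hpath' : ∀ j, 0 ≤ (q : ℤ) + weight q r (u.take j) ∧
      (q : ℤ) + weight q r (u.take j) ≤ q := by
    intro j
    have := hpath (j + 1)
    rwa [hfa, List.take_succ_cons, weight_cons_zero] at this
  have hend : (q : ℤ) + weight q r u = q := by
    rw [hfa, weight_cons_zero] at hx
    exact hx
  have hr1 : r = 1 := by
    have := dvd_of_path hr' u q hu hpath' hend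
    exact Nat.eq_one_of_dvd_coprimes hcop (by exact_mod_cast this) dvd_rfl
  subst hr1
  simp only [Nat.cast_one] at hN hN' hblock hM hx hy hpath' hend
  obtain ⟨k, hk⟩ := eq_of_path u q hu hpath' hend
  have hfa' : f [0] = 0 :: wordPow (List.replicate q 1 ++ [0]) (k + 1) := by
    rw [hfa, hk, wordPow_succ]
    simp
  refine ⟨⟨_, hfa'⟩, fun hmem => ?_⟩
  obtain ⟨L, hL, hL1⟩ : ∃ L, weight q 1 (factor s 0 (L + 1)) = weight q 1 (factor s 0 N') ∧
      s L = 1 := by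
    obtain ⟨L, hL⟩ : ∃ L, weight q 1 (factor s 0 (L + 1)) = weight q 1 (factor s 0 N') := by
      rcases Nat.eq_zero_or_pos N' with h | h
      -- No letter precedes a minimum at position `0`, but `f [0]` starts with `0` followed by `q`
      -- ones, so weight `0` recurs at position `q + 1`.
      · refine ⟨q, ?_⟩
        have h1 := hfix 1
        have h2 : factor s 0 1 = [0] := by simp [factor, h0]
        rw [h2] at h1
        have h3 : factor s 0 (q + 1) = 0 :: List.replicate q 1 := by
          rw [← take_factor s 0 (m := (f [0]).length), ← h1, hfa', wordPow_succ,
            List.take_succ_cons, List.append_assoc, List.take_left' (by simp)]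
          rw [hfa', wordPow_succ]
          simp
        rw [h3, h, weight_cons_zero]
        simp [weight, List.count_replicate]
      · exact ⟨N' - 1, by rw [Nat.sub_add_cancel h]⟩
    refine ⟨L, hL, ?_⟩
    rcases weight_factor_succ s q 1 L with h | h
    · have := hN' L
      linarith [h.2]
    · exact h.1
  have hLw : weight q 1 (factor s 0 (L + 1)) = weight q 1 (factor s 0 L) - 1 := by
    rcases weight_factor_succ s q 1 L with h | h
    · rw [hL1] at h; simp at h
    · exact h.2
  have hpathb : ∀ j, -1 ≤ weight q 1 ((f [1]).take j) ∧ weight q 1 ((f [1]).take j) ≤ 0 := by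
    intro j
    obtain ⟨m1, hm1⟩ := hblock (M + 1) j
    obtain ⟨m2, hm2⟩ := hblock L j
    have a1 := hN m1
    have a2 := hN' m2
    rw [hm1, hN1] at a1
    rw [hm2, hL1] at a2
    push_cast at *
    constructor <;> linarith
  have hq1 : q = 1 := by
    have := le_one_of_mem_of_path hmem hpathb
    omega
  subst hq1
  exact ⟨rfl, (eq_alternating_of_path _).1 (by simpa using hpathb) (by simpa using hy)⟩

end Extremal

/-! ### Primitivity, the determinant and periodic fixed points -/

theorem omegaWord_zero {f : List (Fin 2) → List (Fin 2)} : omegaWord f 0 0 = 0 := by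
  simp [omegaWord]

/-- A zero off-diagonal entry makes the matrix triangular, which persists in its powers. Otherwise
prolongability makes the entry at `(0, 0)` positive and the square is already positive. -/
theorem primitive_iff {f : List (Fin 2) → List (Fin 2)} (hp : IsProlongable f 0) :
    IsPrimitive f ↔ (1 : Fin 2) ∈ f [0] ∧ (0 : Fin 2) ∈ f [1] := by
  obtain ⟨u, hu, hfa⟩ := hp
  constructor
  · rintro ⟨k, hk, h⟩
    constructor
    · by_contra hne
      have h0 : morphismMatrix f 1 0 = 0 := by simpa [morphismMatrix] using List.count_eq_zero_of_not_mem hne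
      have : ∀ k, (morphismMatrix f ^ k) 1 0 = 0 := by
        intro k
        induction k with
        | zero => simp
        | succ k ih => simp [pow_succ, Matrix.mul_apply, Fin.sum_univ_two, ih, h0]
      exact (h 1 0).ne' (this k)
    · by_contra hne
      have h0 : morphismMatrix f 0 1 = 0 := by simpa [morphismMatrix] using List.count_eq_zero_of_not_mem hne
      have : ∀ k, (morphismMatrix f ^ k) 0 1 = 0 := by
        intro k
        induction k with
        | zero => simp
        | succ k ih => simp [pow_succ, Matrix.mul_apply, Fin.sum_univ_two, ih, h0]
      exact (h 0 1).ne' (this k)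
  · rintro ⟨h10, h01⟩
    have a00 : 0 < morphismMatrix f 0 0 := by simp [morphismMatrix, hfa]
    have a10 : 0 < morphismMatrix f 1 0 := by simpa [morphismMatrix, List.count_pos_iff] using h10
    have a01 : 0 < morphismMatrix f 0 1 := by simpa [morphismMatrix, List.count_pos_iff] using h01
    refine ⟨2, by norm_num, fun i j => ?_⟩
    rw [pow_two, Matrix.mul_apply, Fin.sum_univ_two]
    fin_cases i <;> fin_cases j <;> simp <;> simp [a00, a10, a01]

theorem det_eq_mul {f : List (Fin 2) → List (Fin 2)} {θ₁ θ₂ : ℂ}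
    (h : AreOrderedEigenvalues (morphismMatrix f) θ₁ θ₂) :
    ((f [0]).count 0 : ℂ) * (f [1]).count 1 - (f [1]).count 0 * (f [0]).count 1 = θ₁ * θ₂ := by
  have := Matrix.det_eq_prod_roots_charpoly
    ((morphismMatrix f).map (fun n : ℕ => (n : ℂ)))
  rw [h.1, Matrix.det_fin_two] at this
  simpa [morphismMatrix] using this

theorem ne_of_count_eq_zero {s : ℕ → Fin 2} {r p : ℕ} (hp : 0 < p)
    (h : ∀ k : ℕ, AbelianEquiv (factor s r p) (factor s (r + k * p) p)) {c : Fin 2}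
    (hc : (factor s r p).count c = 0) {n : ℕ} (hn : r ≤ n) : s n ≠ c := by
  intro hs
  rw [h ((n - r) / p) c, List.count_eq_zero] at hc
  refine hc (List.mem_map.2 ⟨(n - r) % p, List.mem_range.2 (Nat.mod_lt _ hp), ?_⟩)
  have := Nat.div_add_mod' (n - r) p
  rw [← hs]
  congr 1
  omega

theorem isEventuallyPeriodic_of_count_eq_zero {s : ℕ → Fin 2} {r p : ℕ} (hp : 0 < p)
    (h : ∀ k : ℕ, AbelianEquiv (factor s r p) (factor s (r + k * p) p)) {c : Fin 2}
    (hc : (factor s r p).count c = 0) : IsEventuallyPeriodic s := by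
  refine ⟨r, 1, one_pos, fun n hn => ?_⟩
  have h1 := ne_of_count_eq_zero hp h hc hn
  have h2 := ne_of_count_eq_zero hp h hc (hn.trans (Nat.le_succ n))
  change s (n + 1) ≠ c at h2
  omega

theorem IsEventuallyPeriodic.abelian {s : ℕ → Fin 2} (h : IsEventuallyPeriodic s) :
    IsEventuallyAbelianPeriodic s := by
  obtain ⟨r, p, hp, h⟩ := h
  refine ⟨r, p, hp, fun k c => ?_⟩
  have key : ∀ k j, s (r + k * p + j) = s (r + j) := by
    intro k j
    induction k with
    | zero => simp
    | succ k ih =>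
      rw [← ih, ← h (r + k * p + j) (by omega)]
      congr 1
      ring
  simp only [factor, key]

/-- Each `f^n(0)` has the form `0w⋯w`, so the fixed point is `0www⋯`. -/
theorem isEventuallyPeriodic_of_image_eq_wordPow {f : List (Fin 2) → List (Fin 2)}
    (hf : IsMorphism f) (hn : IsNonerasing f) (hp : IsProlongable f 0) {w : List (Fin 2)}
    (hw : w ≠ []) {k l : ℕ} (h0 : f [0] = 0 :: wordPow w k) (hfw : f w = wordPow w l) :
    IsEventuallyPeriodic (omegaWord f 0) := by
  have hpre := (omegaWord_unique hf hn hp (omegaWord f 0)).1 rfl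
  have hpow : ∀ m, f (wordPow w m) = wordPow w (m * l) := by
    intro m
    induction m with
    | zero => simp [hf.map_nil]
    | succ m ih => rw [wordPow_succ, hf, ih, hfw, ← wordPow_add]; congr 1; ring
  have hiter : ∀ n, ∃ m, f^[n] [0] = 0 :: wordPow w m := by
    intro n
    induction n with
    | zero => exact ⟨0, by simp⟩
    | succ n ih =>
      obtain ⟨m, hm⟩ := ih
      refine ⟨k + m * l, ?_⟩
      rw [Function.iterate_succ_apply', hm, ← List.singleton_append, hf, hpow, h0, wordPow_add]
      rfl
  refine ⟨1, w.length, List.length_pos_iff.2 hw, fun n hn1 => ?_⟩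
  have hlen := lt_length_iterate hf hn hp (n + w.length)
  have hs := hpre (n + w.length)
  obtain ⟨m, hm⟩ := hiter (n + w.length)
  rw [hm] at hlen hs
  obtain ⟨i, rfl⟩ := Nat.exists_eq_add_of_le' hn1
  rw [← hs (i + 1 + w.length) hlen, ← hs (i + 1) (by omega)]
  -- A power of `w` is both a prefix of the next power and what remains of it after deleting the
  -- first `w`, so it has period `w.length`.
  have e1 : wordPow w m = (wordPow w (m + 1)).take (wordPow w m).length := by
    rw [wordPow_add, List.take_left]
  have e2 : wordPow w m = (wordPow w (m + 1)).drop w.length := by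
    rw [wordPow_succ, List.drop_left]
  simp only [List.length_cons] at hlen
  have h1 : (wordPow w m)[i + w.length]? = (wordPow w (m + 1))[i + w.length]? := by
    conv_lhs => rw [e1]
    rw [List.getElem?_take_of_lt (by omega)]
  have h2 : (wordPow w m)[i]? = (wordPow w (m + 1))[i + w.length]? := by
    conv_lhs => rw [e2]
    rw [List.getElem?_drop, add_comm w.length]
  have h3 := h1.trans h2.symm
  rw [List.getElem?_eq_getElem (by omega), List.getElem?_eq_getElem (by omega)] at h3
  simp only [show i + 1 + w.length = i + w.length + 1 by ring, List.getElem_cons_succ]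
  exact Option.some.inj h3

/-- The images of the letters under a morphism with an abelian periodic fixed point in whose
period both letters occur, unless the images have the letter frequencies of the period. -/
theorem shape_of_abelianPeriodic {f : List (Fin 2) → List (Fin 2)} {s : ℕ → Fin 2}
    (hf : IsMorphism f) (hfix : Fixes f s) (h0 : s 0 = 0)
    {u : List (Fin 2)} (hu : u ≠ []) (hfa : f [0] = 0 :: u) {r p : ℕ} (hp : 0 < p)
    (h : ∀ k : ℕ, AbelianEquiv (factor s r p) (factor s (r + k * p) p))
    (hA : 0 < (factor s r p).count 0) (hB : 0 < (factor s r p).count 1)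
    (hne : ¬ (weight ((factor s r p).count 1) ((factor s r p).count 0) (f [0]) = 0 ∧
      weight ((factor s r p).count 1) ((factor s r p).count 0) (f [1]) = 0)) :
    ∃ q, 0 < q ∧ (∃ k, f [0] = 0 :: wordPow (List.replicate q 1 ++ [0]) k) ∧
      ((0 : Fin 2) ∈ f [1] → q = 1 ∧ ∃ m, f [1] = 1 :: wordPow [0, 1] m) ∧
      ((0 : Fin 2) ∉ f [1] → f [1] = [1]) := by
  set A := (factor s r p).count 0 with hAdef
  set B := (factor s r p).count 1 with hBdef
  -- Coprime weights make the multiplier `lam` an integer.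
  obtain ⟨g, q, r', hg, hcop, hBq, hAr⟩ := Nat.exists_coprime' (m := B) (n := A)
    (Nat.gcd_pos_of_pos_left _ hB)
  have hq : 0 < q := Nat.pos_of_mul_pos_right (hBq ▸ hB)
  have hr : 0 < r' := Nat.pos_of_mul_pos_right (hAr ▸ hA)
  have hscale : ∀ w, weight B A w = g * weight q r' w := by
    intro w
    simp only [weight, hBq, hAr]
    push_cast
    ring
  have hg' : (g : ℤ) ≠ 0 := by exact_mod_cast hg.ne'
  rw [hscale, hscale] at hne
  have hper : weight q r' (factor s r p) = 0 := by
    have := weight_self_counts (factor s r p)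
    rw [← hAdef, ← hBdef, hscale] at this
    exact (mul_eq_zero.1 this).resolve_left hg'
  obtain ⟨C, hC⟩ := weight_factor_bounded hp h hper
  have horth := image_weight_orthogonal hf hfix h hC
  rw [← hAdef, ← hBdef, hAr, hBq] at horth
  push_cast at horth
  have horth' : (r' : ℤ) * weight q r' (f [0]) + q * weight q r' (f [1]) = 0 := by
    have : (g : ℤ) * (r' * weight q r' (f [0]) + q * weight q r' (f [1])) = 0 := by
      linear_combination horth
    exact (mul_eq_zero.1 this).resolve_left hg'
  have hq' : (q : ℤ) ≠ 0 := by exact_mod_cast hq.ne'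
  obtain ⟨lam, hlam⟩ : (q : ℤ) ∣ weight q r' (f [0]) := by
    have hc : IsCoprime (q : ℤ) r' := Nat.isCoprime_iff_coprime.2 hcop
    exact hc.dvd_of_dvd_mul_left ⟨- weight q r' (f [1]), by linear_combination horth'⟩
  have hlam1 : weight q r' (f [1]) = -(lam * r') := by
    apply mul_left_cancel₀ hq'
    rw [hlam] at horth'
    linear_combination horth'
  have hlam0 : lam ≠ 0 := by
    rintro rfl
    exact hne ⟨by rw [hlam]; ring, by rw [hlam1]; ring⟩
  rw [mul_comm] at hlam
  have h1 := eigenvalue_eq_one hf hfix h0 hfa hq hr hC hlam hlam1 hlam0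
  subst h1
  rw [one_mul] at hlam hlam1
  obtain ⟨h2, h3⟩ := image_shape hf hfix h0 hu hfa hq hr hcop hC hlam hlam1
  refine ⟨q, hq, h2, h3, fun hn => ?_⟩
  rw [weight, List.count_eq_zero_of_not_mem hn] at hlam1
  have h4 : (r' : ℤ) * ((f [1]).count 1) = r' * 1 := by
    push_cast at hlam1
    linear_combination -hlam1
  have h5 : (f [1]).count 1 = 1 := by
    have := mul_left_cancel₀ (by exact_mod_cast hr.ne') h4
    exact_mod_cast this
  have h6 := count_zero_add_count_one (f [1])
  rw [List.count_eq_zero_of_not_mem hn, h5] at h6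
  obtain ⟨c, hc⟩ := List.length_eq_one_iff.1 h6.symm
  rw [hc] at h5 ⊢
  have := List.count_pos_iff.1 (h5.symm ▸ one_pos)
  rw [List.mem_singleton.1 this]

theorem image_subset_of_mem {α : Type*} {f : List α → List α} (hf : IsMorphism f) {c : α}
    {w : List α} (h : c ∈ w) : f [c] ⊆ f w := by
  obtain ⟨u, v, rfl⟩ := List.append_of_mem h
  rw [show c :: v = [c] ++ v from rfl, hf, hf]
  intro x hx
  simp [hx]

theorem mem_iterate_two {f : List (Fin 2) → List (Fin 2)} (hf : IsMorphism f)
    (hp : IsProlongable f 0) (hprim : IsPrimitive f) (c d : Fin 2) : c ∈ f^[2] [d] := by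
  obtain ⟨h10, h01⟩ := (primitive_iff hp).1 hprim
  have h00 : (0 : Fin 2) ∈ f [0] := by
    obtain ⟨u, -, hfa⟩ := hp
    simp [hfa]
  have h0 : c ∈ f [0] := by
    fin_cases c
    · exact h00
    · exact h10
  have h1 : (0 : Fin 2) ∈ f [d] := by
    fin_cases d
    · exact h00
    · exact h01
  exact image_subset_of_mem hf h1 h0

theorem exists_ge_eq_of_mem_image {f : List (Fin 2) → List (Fin 2)} {s : ℕ → Fin 2}
    (hf : IsMorphism f) (hn : IsNonerasing f) (hfix : Fixes f s) {c : Fin 2}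
    (hc : ∀ d, c ∈ f [d]) (r : ℕ) : ∃ n, r ≤ n ∧ s n = c := by
  obtain ⟨j, hj, hjc⟩ := List.getElem_of_mem (hc (s r))
  refine ⟨(f (factor s 0 r)).length + j, ?_, by rw [hfix.getElem hf r hj, hjc]⟩
  have := hf.length_le hn (factor s 0 r)
  rw [length_factor] at this
  omega

theorem count_pos_of_mem_image {f : List (Fin 2) → List (Fin 2)} {s : ℕ → Fin 2}
    (hf : IsMorphism f) (hn : IsNonerasing f) (hfix : Fixes f s) {c : Fin 2}
    (hc : ∀ d, c ∈ f [d]) {r p : ℕ} (hp : 0 < p)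
    (h : ∀ k : ℕ, AbelianEquiv (factor s r p) (factor s (r + k * p) p)) :
    0 < (factor s r p).count c := by
  obtain ⟨n, hn, hs⟩ := exists_ge_eq_of_mem_image hf hn hfix hc r
  exact Nat.pos_of_ne_zero fun h0 => ne_of_count_eq_zero hp h h0 hn hs

/-! ### Nonzero determinant and non-primitive morphisms -/

section

variable {f : List (Fin 2) → List (Fin 2)}

theorem abelianPeriodic_iff_of_det_ne_zero (hf : IsMorphism f) (hn : IsNonerasing f)
    (hp : IsProlongable f 0) (hprim : IsPrimitive f)
    (hdet : ((f [0]).count 0 : ℤ) * (f [1]).count 1 - (f [1]).count 0 * (f [0]).count 1 ≠ 0) :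
    IsEventuallyAbelianPeriodic (omegaWord f 0) ↔
      ∃ k m : ℕ, f [0] = [0] ++ wordPow [1, 0] k ∧ f [1] = [1] ++ wordPow [0, 1] m := by
  constructor
  · rintro ⟨r, p, hp0, h⟩
    have hfix := fixes_omegaWord hf hn hp
    have hcount := fun c => count_pos_of_mem_image (hf.iterate 2) (hn.iterate hf 2)
      (hfix.iterate 2) (mem_iterate_two hf hp hprim c) hp0 h
    obtain ⟨h10, h01⟩ := (primitive_iff hp).1 hprim
    obtain ⟨u, hu, hfa⟩ := hp
    obtain ⟨q, hq, ⟨k, hk⟩, h1, -⟩ := shape_of_abelianPeriodic hf hfix omegaWord_zero hu hfa hp0 h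
      (hcount 0) (hcount 1) (by
        -- Two vanishing weights put the nonzero row `(B, -A)` in the left kernel of the matrix.
        rintro ⟨h0, h1⟩
        apply hdet
        have h2 : ((factor (omegaWord f 0) r p).count 0 : ℤ) ≠ 0 := by
          exact_mod_cast (hcount 0).ne'
        apply mul_left_cancel₀ h2
        unfold weight at h0 h1
        linear_combination (f [1]).count 0 * h0 - (f [0]).count 0 * h1)
    obtain ⟨rfl, m, hm⟩ := h1 h01
    exact ⟨k, m, hk, hm⟩
  · rintro ⟨k, m, h0, h1⟩
    refine (isEventuallyPeriodic_of_image_eq_wordPow hf hn hp (w := [1, 0]) (l := m + 1 + k)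
      (by simp) h0 ?_).abelian
    have hshift : ∀ m, [1] ++ wordPow [0, 1] m ++ [0] = wordPow [(1 : Fin 2), 0] (m + 1) := by
      intro m
      induction m with
      | zero => rfl
      | succ m ih => rw [wordPow_succ _ (m + 1), ← ih, wordPow_succ]; simp
    rw [show [(1 : Fin 2), 0] = [1] ++ [0] from rfl, hf, h0, h1, ← List.append_assoc, hshift,
      ← wordPow_add]
    rfl

theorem abelianPeriodic_iff_of_not_primitive (hf : IsMorphism f) (hn : IsNonerasing f)
    (hp : IsProlongable f 0) (hprim : ¬ IsPrimitive f) :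
    IsEventuallyAbelianPeriodic (omegaWord f 0) ↔ IsEventuallyPeriodic (omegaWord f 0) := by
  refine ⟨?_, IsEventuallyPeriodic.abelian⟩
  rintro ⟨r, p, hp0, h⟩
  rcases Nat.eq_zero_or_pos ((factor (omegaWord f 0) r p).count 0) with hA | hA
  · exact isEventuallyPeriodic_of_count_eq_zero hp0 h hA
  rcases Nat.eq_zero_or_pos ((factor (omegaWord f 0) r p).count 1) with hB | hB
  · exact isEventuallyPeriodic_of_count_eq_zero hp0 h hB
  rw [primitive_iff hp, not_and_or] at hprim
  have hfix := fixes_omegaWord hf hn hp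
  have hp' := hp
  obtain ⟨u, hu, hfa⟩ := hp'
  have hne : ¬ (weight ((factor (omegaWord f 0) r p).count 1)
      ((factor (omegaWord f 0) r p).count 0) (f [0]) = 0 ∧
      weight ((factor (omegaWord f 0) r p).count 1)
      ((factor (omegaWord f 0) r p).count 0) (f [1]) = 0) := by
    -- A power of `0` has positive weight and a power of `1` negative weight.
    rintro ⟨h0, h1⟩
    rcases hprim with h2 | h2
    · rw [weight, List.count_eq_zero_of_not_mem h2] at h0
      have : 0 < (f [0]).count 0 := by simp [hfa]
      simp at h0
      omega
    · rw [weight, List.count_eq_zero_of_not_mem h2] at h1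
      have h3 := count_zero_add_count_one (f [1])
      rw [List.count_eq_zero_of_not_mem h2] at h3
      have h4 := List.length_pos_iff.2 (hn 1)
      simp at h1
      omega
  obtain ⟨q, hq, ⟨k, hk⟩, -, h1⟩ := shape_of_abelianPeriodic hf hfix omegaWord_zero hu hfa hp0 h
    hA hB hne
  have hk0 : k ≠ 0 := by
    rintro rfl
    rw [hfa] at hk
    simp at hk
    exact hu hk
  have h2 : (0 : Fin 2) ∉ f [1] := by
    refine hprim.resolve_left (not_not.2 ?_)
    obtain ⟨l, rfl⟩ := Nat.exists_eq_succ_of_ne_zero hk0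
    rw [hk, Nat.succ_eq_add_one, wordPow_succ]
    simp [hq.ne']
  refine isEventuallyPeriodic_of_image_eq_wordPow hf hn hp (by simp) hk (l := k + 1) ?_
  have hrep : ∀ q, f (List.replicate q 1) = List.replicate q 1 := by
    intro q
    induction q with
    | zero => exact hf.map_nil
    | succ q ih => rw [List.replicate_succ, ← List.singleton_append, hf, ih, h1 h2]
  rw [hf, hrep, hk, wordPow_succ]
  simp

end

/-! ### Conjugate abelian periods of the images -/

theorem HasAbelianPeriod.weight_take {w P : List (Fin 2)} (h : HasAbelianPeriod w P) {q r : ℤ}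
    (hP : weight q r P = 0) :
    ∃ m, w.length = m * P.length ∧ ∀ k ≤ m, weight q r (w.take (k * P.length)) = 0 := by
  obtain ⟨-, L, -, hL, rfl⟩ := h
  refine ⟨L.length, ?_⟩
  induction L with
  | nil => simp
  | cons x L ih =>
    obtain ⟨ih1, ih2⟩ := ih fun y hy => hL y (List.mem_cons_of_mem _ hy)
    have hx := hL x List.mem_cons_self
    rw [List.flatten_cons]
    refine ⟨by rw [List.length_append, ih1, hx.length_eq, List.length_cons]; ring, ?_⟩
    intro k hk
    cases k with
    | zero => simp
    | succ k =>
      rw [show (k + 1) * P.length = x.length + k * P.length by rw [hx.length_eq]; ring,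
        List.take_length_add_append, weight_append, ih2 k (by simpa using hk),
        hx.weight_eq, hP, add_zero]

theorem hasAbelianPeriod_of_weight_take {q r : ℤ} (hqr : 0 < q + r) {P : List (Fin 2)}
    (hP0 : P ≠ []) (hP : weight q r P = 0) (m : ℕ) :
    ∀ w : List (Fin 2), w.length = (m + 1) * P.length →
      (∀ k ≤ m + 1, weight q r (w.take (k * P.length)) = 0) → HasAbelianPeriod w P := by
  induction m with
  | zero =>
    intro w hw h
    have h1 := h 1 (by omega)
    rw [zero_add, one_mul] at hw
    rw [List.take_of_length_le (by omega)] at h1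
    exact ⟨hP0, [w], by simp, by simpa using abelianEquiv_of_weight_eq hqr hw (h1.trans hP.symm),
      by simp⟩
  | succ m ih =>
    intro w hw h
    have h1 := h 1 (by omega)
    rw [one_mul] at h1
    have hle : P.length ≤ w.length := by rw [hw]; nlinarith
    obtain ⟨-, L, hL, hL', hd⟩ := ih (w.drop P.length) (by
      rw [List.length_drop, hw, show (m + 1 + 1) * P.length = (m + 1) * P.length + P.length by ring]
      omega) (fun k hk => by
        have h2 := h (k + 1) (by omega)
        rw [show (k + 1) * P.length = P.length + k * P.length by ring, List.take_add,
          weight_append, h1, zero_add] at h2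
        exact h2)
    refine ⟨hP0, w.take P.length :: L, by simp, ?_, ?_⟩
    · intro x hx
      rcases List.mem_cons.1 hx with rfl | hx
      · exact abelianEquiv_of_weight_eq hqr (by simp [hle]) (h1.trans hP.symm)
      · exact hL' x hx
    · rw [List.flatten_cons, ← hd, List.take_append_drop]

/-- Read cyclically from the cut after `u`, the word `u ++ v` becomes `v ++ u`, so the places
congruent to `u.length` are the period boundaries of `v ++ u`. Those left of the cut are boundaries
near its end. -/
theorem weight_take_append_of_conjugate {u v : List (Fin 2)} {q r : ℤ} {p m : ℕ}
    (hl : (v ++ u).length = m * p)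
    (h : ∀ k ≤ m, weight q r ((v ++ u).take (k * p)) = 0) {j : ℕ}
    (hj : j ≤ (u ++ v).length) (hmod : j ≡ u.length [MOD p]) :
    weight q r ((u ++ v).take j) = weight q r u := by
  rcases Nat.eq_zero_or_pos p with rfl | hp
  · have : j = u.length := by simpa [Nat.ModEq] using hmod
    rw [this, List.take_left]
  rw [List.length_append] at hl hj
  rcases le_total u.length j with hle | hle
  · obtain ⟨k, hk⟩ := (Nat.modEq_iff_dvd' hle).1 hmod.symm
    have hjk : j = u.length + k * p := by rw [mul_comm] at hk; omega
    have hkm : k ≤ m := by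
      by_contra hlt
      have : m * p + p ≤ k * p := by nlinarith
      omega
    have h1 := h k hkm
    rw [List.take_append_of_le_length (by omega)] at h1
    rw [hjk, List.take_length_add_append, weight_append, h1, add_zero]
  · obtain ⟨k, hk⟩ := (Nat.modEq_iff_dvd' hle).1 hmod
    have hjk : u.length = j + k * p := by rw [mul_comm] at hk; omega
    have hkm : k ≤ m := by
      by_contra hlt
      have : m * p + p ≤ k * p := by nlinarith
      omega
    have h1 := h (m - k) (Nat.sub_le _ _)
    have h2 := h m le_rfl
    have hmk : (m - k) * p + k * p = m * p := by rw [← add_mul, Nat.sub_add_cancel hkm]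
    rw [List.take_of_length_le (by rw [List.length_append]; omega)] at h2
    have h3 : v ++ u = (v ++ u).take ((m - k) * p) ++ u.drop j := by
      have h4 : (v ++ u).take ((m - k) * p) = v ++ u.take j := by
        rw [show (m - k) * p = v.length + j by omega, List.take_length_add_append]
      rw [h4, List.append_assoc, List.take_append_drop]
    rw [h3, weight_append, h1, zero_add] at h2
    rw [List.take_append_of_le_length hle]
    conv_rhs => rw [← List.take_append_drop j u, weight_append, h2, add_zero]

/-- Complete blocks have weight zero and length divisible by `p`, so they affect neither the prefix
weight nor the residue of a position. -/
theorem abelianPeriodic_of_blocks {F : List (Fin 2) → List (Fin 2)} {s : ℕ → Fin 2}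
    (hF : IsMorphism F) (hn : IsNonerasing F) (hfix : Fixes F s) {q r δ : ℤ} (hqr : 0 < q + r)
    {p ρ : ℕ} (hp : 0 < p) (hdvd : ∀ c, p ∣ (F [c]).length) (hw : ∀ c, weight q r (F [c]) = 0)
    (h : ∀ c, ∀ j ≤ (F [c]).length, j ≡ ρ [MOD p] → weight q r ((F [c]).take j) = δ) :
    IsEventuallyAbelianPeriodic s := by
  have key : ∀ n, n ≡ ρ [MOD p] → weight q r (factor s 0 n) = δ := by
    intro n hmod
    obtain ⟨i, j, hj, rfl⟩ := Fixes.exists_block (s := s) hF hn n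
    rw [hfix.factor_add hF i hj.le, weight_append, weight_image q r hF, hw, hw]
    simp only [mul_zero, zero_add]
    refine h _ _ hj.le (Nat.ModEq.trans ?_ hmod)
    have hd : p ∣ (F (factor s 0 i)).length := by
      rw [length_image hF]
      exact dvd_add (dvd_mul_of_dvd_right (hdvd 0) _) (dvd_mul_of_dvd_right (hdvd 1) _)
    obtain ⟨e, he⟩ := hd
    rw [he]
    simp [Nat.ModEq]
  have hfac : ∀ k, weight q r (factor s (ρ + k * p) p) = 0 := by
    intro k
    have h1 := key (ρ + k * p) (by simp [Nat.ModEq])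
    have h2 := key (ρ + k * p + p) (by simp [Nat.ModEq])
    rw [factor_add, weight_append, h1, zero_add] at h2
    linarith
  refine ⟨ρ, p, hp, fun k => abelianEquiv_of_weight_eq hqr (by simp) ?_⟩
  have h0 := hfac 0
  rw [zero_mul, add_zero] at h0
  rw [h0, hfac]

theorem abelianPeriodic_of_conjugate_periods {F : List (Fin 2) → List (Fin 2)}
    {s : ℕ → Fin 2} (hF : IsMorphism F) (hn : IsNonerasing F) (hfix : Fixes F s)
    {u v u' v' P P' : List (Fin 2)} (h0 : F [0] = u ++ v) (h1 : F [1] = u' ++ v')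
    (huu : AbelianEquiv u u') (hP : HasAbelianPeriod (v ++ u) P)
    (hP' : HasAbelianPeriod (v' ++ u') P') (hPP : AbelianEquiv P P') :
    IsEventuallyAbelianPeriodic s := by
  have hwP := weight_self_counts P
  have hwP' := (hPP.weight_eq (P.count 1) (P.count 0)).symm.trans hwP
  obtain ⟨m, hm, hm'⟩ := hP.weight_take hwP
  obtain ⟨l, hl, hl'⟩ := hP'.weight_take hwP'
  have hlen := List.length_pos_iff.2 hP.1
  rw [← hPP.length_eq] at hl hl'
  have hpos : (0 : ℤ) < (P.count 1 : ℤ) + P.count 0 := by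
    have := count_zero_add_count_one P
    omega
  have hw0 := hm' m le_rfl
  rw [List.take_of_length_le hm.le] at hw0
  have hw1 := hl' l le_rfl
  rw [List.take_of_length_le hl.le] at hw1
  have hlu : (F [0]).length = m * P.length := by rw [h0, ← hm]; simp [add_comm]
  have hlu' : (F [1]).length = l * P.length := by rw [h1, ← hl]; simp [add_comm]
  refine abelianPeriodic_of_blocks (δ := weight (P.count 1) (P.count 0) u) (ρ := u.length)
    hF hn hfix hpos hlen ?_ ?_ ?_
  · intro c
    fin_cases c
    · exact Dvd.intro_left _ hlu.symm
    · exact Dvd.intro_left _ hlu'.symm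
  · intro c
    fin_cases c
    · change weight _ _ (F [0]) = 0
      rw [h0, weight_append, add_comm, ← weight_append, hw0]
    · change weight _ _ (F [1]) = 0
      rw [h1, weight_append, add_comm, ← weight_append, hw1]
  · intro c
    fin_cases c
    · change ∀ j ≤ (F [0]).length, _ → weight _ _ ((F [0]).take j) = _
      rw [h0]
      intro j hj hmod
      exact weight_take_append_of_conjugate hm hm' hj hmod
    · change ∀ j ≤ (F [1]).length, _ → weight _ _ ((F [1]).take j) = _
      rw [h1, huu.weight_eq, huu.length_eq]
      intro j hj hmod
      exact weight_take_append_of_conjugate hl hl' hj hmod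

theorem exists_conjugate_periods {F : List (Fin 2) → List (Fin 2)} (hn : IsNonerasing F)
    {q r δ : ℤ} (hqr : 0 < q + r) {p ρ : ℕ} (hp : 0 < p) (hdvd : ∀ c, p ∣ (F [c]).length)
    (hw : ∀ c, weight q r (F [c]) = 0)
    (h : ∀ c, ∀ j ≤ (F [c]).length, j ≡ ρ [MOD p] → weight q r ((F [c]).take j) = δ) :
    ∃ u v u' v' : List (Fin 2), F [0] = u ++ v ∧ F [1] = u' ++ v' ∧ AbelianEquiv u u' ∧
      ∃ P P' : List (Fin 2), HasAbelianPeriod (v ++ u) P ∧ HasAbelianPeriod (v' ++ u') P' ∧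
        AbelianEquiv P P' := by
  have hlt : ρ % p < p := Nat.mod_lt _ hp
  have hle : ∀ c, p ≤ (F [c]).length := fun c =>
    Nat.le_of_dvd (List.length_pos_iff.2 (hn c)) (hdvd c)
  have hu : ∀ c, weight q r ((F [c]).take (ρ % p)) = δ := fun c =>
    h c _ (hlt.le.trans (hle c)) (Nat.mod_modEq _ _)
  have hconj : ∀ c, weight q r ((F [c]).drop (ρ % p) ++ (F [c]).take (ρ % p)) = 0 := by
    intro c
    rw [weight_append, add_comm, ← weight_append, List.take_append_drop, hw]
  have hlen : ∀ c, ((F [c]).drop (ρ % p) ++ (F [c]).take (ρ % p)).length = (F [c]).length := by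
    intro c
    rw [List.length_append, add_comm, ← List.length_append, List.take_append_drop]
  have hper : ∀ c k, k * p ≤ (F [c]).length →
      weight q r (((F [c]).drop (ρ % p) ++ (F [c]).take (ρ % p)).take (k * p)) = 0 := by
    intro c k hk
    by_cases hkp : ρ % p + k * p ≤ (F [c]).length
    · rw [List.take_append_of_le_length (by rw [List.length_drop]; omega)]
      have h1 := h c (ρ % p + k * p) hkp (by simp [Nat.ModEq])
      rw [List.take_add, weight_append, hu] at h1
      linarith
    -- The boundary wraps past the end of `F [c]` only when it is the end of the whole conjugate.
    · obtain ⟨m, hm⟩ := hdvd c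
      have hkm : k = m := by
        apply le_antisymm
        · rw [hm, mul_comm p] at hk
          exact Nat.le_of_mul_le_mul_right hk hp
        · by_contra hlt'
          have : k * p + p ≤ m * p := by nlinarith
          rw [mul_comm] at hm
          omega
      rw [List.take_of_length_le (by rw [hlen, hm, hkm, mul_comm]), hconj]
  have hP : ∀ c, (((F [c]).drop (ρ % p) ++ (F [c]).take (ρ % p)).take p).length = p := by
    intro c
    rw [List.length_take, hlen, min_eq_left (hle c)]
  have hwP : ∀ c, weight q r (((F [c]).drop (ρ % p) ++ (F [c]).take (ρ % p)).take p) = 0 := by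
    intro c
    have := hper c 1 (by rw [one_mul]; exact hle c)
    rwa [one_mul] at this
  have hfin : ∀ c, HasAbelianPeriod ((F [c]).drop (ρ % p) ++ (F [c]).take (ρ % p))
      (((F [c]).drop (ρ % p) ++ (F [c]).take (ρ % p)).take p) := by
    intro c
    obtain ⟨m, hm⟩ := hdvd c
    obtain ⟨m, rfl⟩ := Nat.exists_eq_succ_of_ne_zero (n := m) (by
      rintro rfl
      have := hle c
      omega)
    refine hasAbelianPeriod_of_weight_take hqr ?_ (hwP c) m _ ?_ ?_
    · rw [← List.length_pos_iff, hP]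
      exact hp
    · rw [hP, hlen, hm, mul_comm]
    · intro k hk
      rw [hP]
      refine hper c k ?_
      rw [hm, mul_comm p]
      exact Nat.mul_le_mul_right p hk
  refine ⟨_, _, _, _, (List.take_append_drop (ρ % p) _).symm,
    (List.take_append_drop (ρ % p) _).symm, abelianEquiv_of_weight_eq hqr ?_ ?_, _, _,
    hfin 0, hfin 1, abelianEquiv_of_weight_eq hqr ?_ ?_⟩
  · have h0 := hle 0
    have h1 := hle 1
    rw [List.length_take, List.length_take, min_eq_left (by omega), min_eq_left (by omega)]
  · rw [hu, hu]
  · rw [hP, hP]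
  · rw [hwP, hwP]

/-! ### Finite monoids and groups, and lengths of iterates -/

theorem exists_idempotent_pow {M : Type*} [Monoid M] [Finite M] (t : M) (r : ℕ) :
    ∃ N, 0 < N ∧ r ≤ N ∧ t ^ (N + N) = t ^ N := by
  obtain ⟨a, b, hne, hab⟩ := Finite.exists_ne_map_eq_of_infinite (fun n : ℕ => t ^ n)
  wlog hlt : a < b generalizing a b
  · exact this b a hne.symm hab.symm (by omega)
  obtain ⟨d, rfl⟩ := Nat.exists_eq_add_of_lt hlt
  have hab' : t ^ (a + (d + 1)) = t ^ a := hab.symm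
  have hstep : ∀ n, a ≤ n → ∀ k, t ^ (n + k * (d + 1)) = t ^ n := by
    intro n hn k
    induction k with
    | zero => simp
    | succ k ih =>
      obtain ⟨e, rfl⟩ := Nat.exists_eq_add_of_le hn
      rw [← ih, show a + e + (k + 1) * (d + 1) = (a + (d + 1)) + (e + k * (d + 1)) by ring,
        pow_add, hab', ← pow_add, add_assoc]
  -- A multiple of the period `d + 1` of the powers, past both their preperiod `a` and `r`.
  refine ⟨(a + 1 + r) * (d + 1), by positivity, ?_, hstep _ ?_ _⟩
  · nlinarith
  · nlinarith

/-- A nonempty subset of a finite additive group that is closed under addition is a subgroup. -/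
theorem exists_addSubgroup_coe_eq {Z : Type*} [AddCommGroup Z] [Finite Z] {X : Set Z}
    (hX : X.Nonempty) (hadd : ∀ x ∈ X, ∀ y ∈ X, x + y ∈ X) :
    ∃ H : AddSubgroup Z, (H : Set Z) = X := by
  have hsmul : ∀ x ∈ X, ∀ n : ℕ, (n + 1) • x ∈ X := by
    intro x hx n
    induction n with
    | zero => simpa using hx
    | succ n ih => rw [succ_nsmul]; exact hadd _ ih _ hx
  have hzero : ∀ x : Z, ∃ n : ℕ, (n + 1) • x = 0 := fun x =>
    ⟨addOrderOf x - 1, by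
      rw [Nat.sub_add_cancel (addOrderOf_pos x), addOrderOf_nsmul_eq_zero]⟩
  refine ⟨⟨⟨⟨X, fun {x y} hx hy => hadd x hx y hy⟩, ?_⟩, ?_⟩, rfl⟩
  · obtain ⟨x, hx⟩ := hX
    obtain ⟨n, hn⟩ := hzero x
    exact hn ▸ hsmul x hx n
  · intro x hx
    obtain ⟨n, hn⟩ := hzero x
    -- The multiple `2 * n + 1`, unlike `n`, is positive even when `x = 0` and `n = 0`.
    have h1 : -x = (2 * n + 1) • x := by
      rw [neg_eq_iff_add_eq_zero, ← succ_nsmul', show 2 * n + 1 + 1 = 2 * (n + 1) by ring,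
        mul_nsmul', hn, nsmul_zero]
    change -x ∈ X
    rw [h1]
    exact hsmul x hx _

theorem exists_eq_and_succ_eq {s : ℕ → Fin 2} {c d : Fin 2} (hcd : c ≠ d) {m n : ℕ}
    (hmn : m ≤ n) (hm : s m = c) (hn : s n = d) : ∃ i, m ≤ i ∧ s i = c ∧ s (i + 1) = d := by
  by_contra! hno
  have : ∀ n, m ≤ n → s n = c := by
    intro n hn
    induction n, hn using Nat.le_induction with
    | base => exact hm
    | succ k hk ih =>
      have := hno k hk ih
      omega
  exact hcd ((this n hmn).symm.trans hn)

theorem count_factor_of_alternating {s : ℕ → Fin 2} (h : ∀ i, s i ≠ s (i + 1)) (i k : ℕ)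
    (c : Fin 2) : (factor s i (2 * k)).count c = k := by
  induction k with
  | zero => simp
  | succ k ih =>
    rw [show 2 * (k + 1) = 2 * k + 1 + 1 by ring, factor_succ, factor_succ, List.count_append,
      List.count_append, ih]
    have h1 := h (i + 2 * k)
    rw [add_assoc] at h1
    generalize s (i + 2 * k) = x at h1 ⊢
    generalize s (i + (2 * k + 1)) = y at h1 ⊢
    have key : ∀ c x y : Fin 2, x ≠ y → [x].count c + [y].count c = 1 := by decide
    rw [add_assoc, key c x y h1]

/-- By Cayley–Hamilton, a `2 × 2` matrix `M` of determinant zero satisfies `M² = tr(M) M`. -/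
theorem length_image_image {f : List (Fin 2) → List (Fin 2)} (hf : IsMorphism f)
    (hdet : ((f [0]).count 0 : ℤ) * (f [1]).count 1 - (f [1]).count 0 * (f [0]).count 1 = 0)
    (w : List (Fin 2)) :
    (f (f w)).length = ((f [0]).count 0 + (f [1]).count 1) * (f w).length := by
  have hc : ∀ c, (f w).count c = w.count 0 * (f [0]).count c + w.count 1 * (f [1]).count c := by
    intro c
    have := additive_eq (fun w => (f w).count c) (by simp [hf.map_nil])
      (fun u v => by simp only [hf u v, List.count_append]) w
    simpa using this
  rw [length_image hf (f w), length_image hf w, hc, hc, ← count_zero_add_count_one (f [0]),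
    ← count_zero_add_count_one (f [1])]
  zify
  linear_combination (-(w.count 0 : ℤ) - w.count 1) * hdet

theorem length_iterate_succ {f : List (Fin 2) → List (Fin 2)} (hf : IsMorphism f)
    (hdet : ((f [0]).count 0 : ℤ) * (f [1]).count 1 - (f [1]).count 0 * (f [0]).count 1 = 0)
    (k : ℕ) (w : List (Fin 2)) :
    (f^[k + 1] w).length = ((f [0]).count 0 + (f [1]).count 1) ^ k * (f w).length := by
  induction k generalizing w with
  | zero => simp
  | succ k ih =>
    rw [Function.iterate_succ_apply, ih, length_image_image hf hdet]
    ring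

theorem gcd_mem_addSubgroup {H : AddSubgroup ℤ} {a b : ℕ} (ha : (a : ℤ) ∈ H)
    (hb : (b : ℤ) ∈ H) : (Nat.gcd a b : ℤ) ∈ H := by
  rw [Nat.gcd_eq_gcd_ab, mul_comm (a : ℤ), mul_comm (b : ℤ), ← smul_eq_mul, ← smul_eq_mul]
  exact H.add_mem (H.zsmul_mem ha _) (H.zsmul_mem hb _)

theorem zero_mem_iterate {f : List (Fin 2) → List (Fin 2)} (hf : IsMorphism f)
    (h : ∀ c, (0 : Fin 2) ∈ f [c]) (k : ℕ) (c : Fin 2) : (0 : Fin 2) ∈ f^[k + 1] [c] := by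
  induction k with
  | zero => exact h c
  | succ k ih =>
    rw [Function.iterate_succ_apply']
    exact image_subset_of_mem hf ih (h 0)

/-! ### Zero determinant: residues of block positions -/

section Rank

variable {f : List (Fin 2) → List (Fin 2)}

/-- The residues attained by an additive function that is invariant under a power of the morphism,
at the occurrences of each letter, include the subgroup generated by its values on the letters. -/
theorem exists_addSubgroup_residues (hf : IsMorphism f) (hn : IsNonerasing f)
    (hp : IsProlongable f 0) (hprim : IsPrimitive f) {Z : Type*} [AddCommGroup Z] [Finite Z]
    (φ : List (Fin 2) → Z) (hφ : ∀ u v, φ (u ++ v) = φ u + φ v) {N : ℕ} (hN : 0 < N)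
    (hφN : ∀ w, φ (f^[N] w) = φ w)
    (halt : (∀ i, omegaWord f 0 i ≠ omegaWord f 0 (i + 1)) →
      ∀ w, (f w).count 0 = (f w).count 1) :
    ∃ H : AddSubgroup Z, (∀ c, φ [c] ∈ H) ∧ ∀ c, ∀ g ∈ H, ∃ i, 1 ≤ i ∧ omegaWord f 0 i = c ∧
      φ (factor (omegaWord f 0) 0 i) = g := by
  have hfix := fixes_omegaWord hf hn hp
  have hpre := (omegaWord_unique hf hn hp (omegaWord f 0)).1 rfl
  have hs0 : omegaWord f 0 0 = 0 := omegaWord_zero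
  have hlen := lt_length_iterate hf hn hp
  obtain ⟨h10, h01⟩ := (primitive_iff hp).1 hprim
  have h00 : ∀ c, (0 : Fin 2) ∈ f [c] := by
    obtain ⟨u, -, hfa⟩ := hp
    intro c
    fin_cases c
    · simp [hfa]
    · exact h01
  have hrec := fun c => exists_ge_eq_of_mem_image (hf.iterate 2) (hn.iterate hf 2)
    (hfix.iterate 2) (mem_iterate_two hf hp hprim c)
  set s := omegaWord f 0 with hs
  have hφ0 : φ [] = 0 := by simpa using hφ [] []
  have hφpow : ∀ n w, φ (f^[N * n] w) = φ w := by
    intro n w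
    induction n with
    | zero => rfl
    | succ n ih => rw [mul_add, mul_one, add_comm, Function.iterate_add_apply, hφN, ih]
  have hφsucc : ∀ i, φ (factor s 0 (i + 1)) = φ (factor s 0 i) + φ [s i] := by
    intro i
    rw [factor_succ, hφ, zero_add]
  set X : Fin 2 → Set Z := fun c => {z | ∃ i, 1 ≤ i ∧ s i = c ∧ φ (factor s 0 i) = z} with hX
  -- Under `f^[N * j]` the letter `0` at position `i` becomes a block beginning with the first `j +
  -- 1` letters of `s`. As `φ` is invariant, its values at `i` and `j` add up at place `j` of that
  -- block.
  have hadd : ∀ c, ∀ x ∈ X 0, ∀ y ∈ X c, x + y ∈ X c := by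
    rintro c _ ⟨i, hi, hsi, rfl⟩ _ ⟨j, hj, hsj, rfl⟩
    have hjl : j < (f^[N * j] [s i]).length := by
      rw [hsi]
      exact lt_of_le_of_lt (Nat.le_mul_of_pos_left j hN) (hlen (N * j))
    refine ⟨(f^[N * j] (factor s 0 i)).length + j, by omega, ?_, ?_⟩
    · rw [(hfix.iterate _).getElem (hf.iterate _) i hjl, ← hsj]
      have := hpre (N * j) j (by rwa [hsi] at hjl)
      simp only [hsi]
      exact this
    · rw [(hfix.iterate _).factor_add (hf.iterate _) i hjl.le, hφ, hφpow, hsi,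
        (hpre (N * j)).eq_factor, take_factor _ _ (by rw [hsi] at hjl; exact hjl.le)]
  have hX0 : (X 0).Nonempty := by
    obtain ⟨i, hi, hsi⟩ := hrec 0 1
    exact ⟨_, i, hi, hsi, rfl⟩
  obtain ⟨H, hH⟩ := exists_addSubgroup_coe_eq hX0 (hadd 0)
  have hmem : ∀ z, z ∈ H ↔ z ∈ X 0 := fun z => by rw [← hH]; rfl
  -- As `f^[N] [1]` contains a `0`, one shift `o` carries all of `X 1` into `H`: it lies in a single
  -- coset.
  have hback : ∃ o, ∀ z ∈ X 1, z + o ∈ H := by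
    obtain ⟨M, rfl⟩ := Nat.exists_eq_succ_of_ne_zero hN.ne'
    obtain ⟨j, hj, hj0⟩ := List.getElem_of_mem (zero_mem_iterate hf h00 M 1)
    refine ⟨φ ((f^[M + 1] [1]).take j), ?_⟩
    rintro _ ⟨i, hi, hsi, rfl⟩
    have hjl : j < (f^[M + 1] [s i]).length := by rw [hsi]; exact hj
    rw [hmem]
    refine ⟨(f^[M + 1] (factor s 0 i)).length + j, ?_, ?_, ?_⟩
    · have := (hf.iterate (M + 1)).length_le (hn.iterate hf (M + 1)) (factor s 0 i)
      rw [length_factor] at this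
      omega
    · rw [(hfix.iterate _).getElem (hf.iterate _) i hjl]
      simp only [hsi]
      exact hj0
    · rw [(hfix.iterate _).factor_add (hf.iterate _) i hjl.le, hφ, hφN, hsi]
  obtain ⟨o, ho⟩ := hback
  have hsub : ∀ y ∈ X 1, ∀ z ∈ X 1, y - z ∈ H := by
    intro y hy z hz
    have := H.sub_mem (ho y hy) (ho z hz)
    rwa [add_sub_add_right_eq_sub] at this
  have hat0 : ∀ i, s i = 0 → φ (factor s 0 i) ∈ H := by
    intro i hi
    rcases Nat.eq_zero_or_pos i with rfl | hpos
    · simp [hφ0]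
    · exact (hmem _).2 ⟨i, hpos, hi, rfl⟩
  have hat1 : ∀ i, s i = 1 → φ (factor s 0 i) ∈ X 1 := by
    intro i hi
    refine ⟨i, Nat.pos_of_ne_zero ?_, hi, rfl⟩
    rintro rfl
    rw [hs0] at hi
    exact absurd hi (by decide)
  obtain ⟨n, -, hn1⟩ := hrec 1 0
  obtain ⟨a, -, ha0, ha1⟩ := exists_eq_and_succ_eq (by decide) (Nat.zero_le n) hs0 hn1
  obtain ⟨m, hm, hm0⟩ := hrec 0 n
  obtain ⟨b, -, hb1, hb0⟩ := exists_eq_and_succ_eq (by decide) hm hn1 hm0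
  set g := φ (factor s 0 a) with hg
  set z := φ (factor s 0 b) with hz
  have hgH : g ∈ H := hat0 a ha0
  have hzX : z ∈ X 1 := hat1 b hb1
  have hgx : g + φ [0] ∈ X 1 := by
    have := hat1 (a + 1) ha1
    rwa [hφsucc, ha0] at this
  have hzy : z + φ [1] ∈ H := by
    have := hat0 (b + 1) hb0
    rwa [hφsucc, hb1] at this
  have hxy : φ [0] + φ [1] ∈ H := by
    have := H.sub_mem (H.add_mem (hsub _ hgx _ hzX) hzy) hgH
    rwa [show g + φ [0] - z + (z + φ [1]) - g = φ [0] + φ [1] by abel] at this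
  -- A factor `00` or `11` puts `φ` of its letter in `H`. An alternating word has neither, but then
  -- `halt` makes `φ [0] = φ (f^[N] [0])` a multiple of `φ [0] + φ [1]`.
  have hx : φ [0] ∈ H := by
    by_cases hne : ∀ i, s i ≠ s (i + 1)
    · have hcount := halt hne (f^[N - 1] [0])
      rw [← Function.iterate_succ_apply' f, Nat.succ_eq_add_one, Nat.sub_add_cancel hN] at hcount
      have h1 := additive_eq φ hφ0 hφ (f^[N] [0])
      rw [hφN, ← hcount, ← nsmul_add] at h1
      rw [h1]
      exact H.nsmul_mem hxy _
    · push Not at hne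
      obtain ⟨i, hi⟩ := hne
      have h01 : s i = 0 ∨ s i = 1 := by omega
      rcases h01 with h | h
      · have h1 := hat0 i h
        have h2 := hat0 (i + 1) (hi ▸ h)
        rw [hφsucc, h] at h2
        simpa using H.sub_mem h2 h1
      · have h1 := hat1 i h
        have h2 := hat1 (i + 1) (hi ▸ h)
        rw [hφsucc, h] at h2
        have h3 := hsub _ h2 _ h1
        rw [add_sub_cancel_left] at h3
        simpa using H.sub_mem hxy h3
  have hy : φ [1] ∈ H := by simpa using H.sub_mem hxy hx
  have hzH : z ∈ H := by simpa using H.sub_mem hzy hy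
  refine ⟨H, fun c => ?_, fun c y hyH => ?_⟩
  · fin_cases c
    · exact hx
    · exact hy
  · fin_cases c
    · exact (hmem y).1 hyH
    · have := hadd 1 (y - z) ((hmem _).1 (H.sub_mem hyH hzH)) z hzX
      rwa [sub_add_cancel] at this

theorem exists_conjugate_periods_of_abelianPeriodic (hf : IsMorphism f) (hn : IsNonerasing f)
    (hp : IsProlongable f 0) (hprim : IsPrimitive f)
    (hdet : ((f [0]).count 0 : ℤ) * (f [1]).count 1 - (f [1]).count 0 * (f [0]).count 1 = 0)
    (hab : IsEventuallyAbelianPeriodic (omegaWord f 0)) :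
    ∃ (K : ℕ) (u v u' v' : List (Fin 2)), f^[K] [0] = u ++ v ∧ f^[K] [1] = u' ++ v' ∧
      AbelianEquiv u u' ∧ ∃ P P' : List (Fin 2), HasAbelianPeriod (v ++ u) P ∧
        HasAbelianPeriod (v' ++ u') P' ∧ AbelianEquiv P P' := by
  obtain ⟨r, p, hp0, h⟩ := hab
  have hfix := fixes_omegaWord hf hn hp
  have hlen := lt_length_iterate hf hn hp
  have hcount := fun c => count_pos_of_mem_image (hf.iterate 2) (hn.iterate hf 2)
    (hfix.iterate 2) (mem_iterate_two hf hp hprim c) hp0 h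
  obtain ⟨h10, h01⟩ := (primitive_iff hp).1 hprim
  have h00 : (0 : Fin 2) ∈ f [0] := by
    obtain ⟨u, -, hfa⟩ := hp
    simp [hfa]
  have hA := hcount 0
  have hB := hcount 1
  set s := omegaWord f 0 with hs
  set A := (factor s r p).count 0 with hAdef
  set B := (factor s r p).count 1 with hBdef
  have hper : weight B A (factor s r p) = 0 := weight_self_counts _
  obtain ⟨C, hC⟩ := weight_factor_bounded hp0 h hper
  have horth := image_weight_orthogonal hf hfix h hC
  rw [← hAdef, ← hBdef] at horth
  have hA' : (0 : ℤ) < A := by exact_mod_cast hA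
  have hB' : (0 : ℤ) < B := by exact_mod_cast hB
  -- With determinant zero, the weights of `f [0]` and `f [1]` are proportional to their positive
  -- counts of `0`; orthogonality to the positive vector `(A, B)` then kills both.
  have hw0 : weight B A (f [0]) = 0 := by
    have h1 : (0 : ℤ) < (f [0]).count 0 := by exact_mod_cast List.count_pos_iff.2 h00
    have h2 : (0 : ℤ) < (f [1]).count 0 := by exact_mod_cast List.count_pos_iff.2 h01
    have h3 : (A * (f [0]).count 0 + B * (f [1]).count 0) * weight B A (f [0]) = 0 := by
      unfold weight at horth ⊢
      linear_combination (f [0]).count 0 * horth + A * B * hdet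
    exact (mul_eq_zero.1 h3).resolve_left (by positivity)
  have hw1 : weight B A (f [1]) = 0 := by
    rw [hw0, mul_zero, zero_add] at horth
    exact (mul_eq_zero.1 horth).resolve_left hB'.ne'
  have hw : ∀ w, weight B A (f w) = 0 := fun w => by
    rw [weight_image _ _ hf, hw0, hw1, mul_zero, mul_zero, add_zero]
  have : NeZero p := ⟨hp0.ne'⟩
  set t := (f [0]).count 0 + (f [1]).count 1 with ht
  -- Idempotence of `t ^ N` makes the length of `f^[N + 1] w` modulo `p` invariant under `f^[N]`; `r
  -- ≤ N` makes `f^[N + 1] [0]` longer than the preperiod.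
  obtain ⟨N, hN0, hNr, hN⟩ := exists_idempotent_pow (t : ZMod p) r
  have hφN : ∀ w, ((f^[N + 1] (f^[N] w)).length : ZMod p) = ((f^[N + 1] w).length : ZMod p) := by
    intro w
    rw [← Function.iterate_add_apply, show N + 1 + N = N + N + 1 by ring,
      length_iterate_succ hf hdet, length_iterate_succ hf hdet]
    rw [← ht, Nat.cast_mul, Nat.cast_mul, Nat.cast_pow, Nat.cast_pow, hN]
  obtain ⟨H, hH, hres⟩ := exists_addSubgroup_residues hf hn hp hprim
    (fun w => ((f^[N + 1] w).length : ZMod p))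
    (fun u v => by simp [hf.iterate (N + 1) u v]) hN0 hφN (by
      intro hne w
      rw [← hs] at hne
      -- In an alternating word two periods contain each letter `p` times.
      have hAB : (A : ℤ) = B := by
        have h1 := weight_factor_of_abelianPeriodic h hper 2
        rw [factor_add, weight_append, add_eq_left, zero_add, weight, count_factor_of_alternating hne,
          count_factor_of_alternating hne] at h1
        have h2 : (p : ℤ) * (B - A) = 0 := by linear_combination h1
        have := (mul_eq_zero.1 h2).resolve_left (by exact_mod_cast hp0.ne')
        linarith
      have h3 := hw w
      rw [weight, hAB] at h3
      have h4 : (B : ℤ) * ((f w).count 0 - (f w).count 1) = 0 := by linear_combination h3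
      have := (mul_eq_zero.1 h4).resolve_left hB'.ne'
      omega)
  rw [← hs] at hres
  set F := f^[N + 1] with hF
  have hFm : IsMorphism F := hf.iterate _
  have hFn : IsNonerasing F := hn.iterate hf _
  have hFfix : Fixes F s := hfix.iterate _
  -- This divides both block lengths, and by Bézout its residue modulo `p` lies in `H`.
  set p' := Nat.gcd p (Nat.gcd (F [0]).length (F [1]).length) with hp'
  have hp'0 : 0 < p' := Nat.gcd_pos_of_pos_left _ hp0
  have hp'H : ((p' : ℤ) : ZMod p) ∈ H := by
    have : (p' : ℤ) ∈ H.comap (Int.castAddHom (ZMod p)) := by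
      refine gcd_mem_addSubgroup ?_ (gcd_mem_addSubgroup ?_ ?_)
      · simp
      · simpa using hH 0
      · simpa using hH 1
    simpa using this
  have hwF : ∀ w, weight B A (F w) = 0 := fun w => by
    rw [hF, Function.iterate_succ_apply', hw]
  refine ⟨N + 1, exists_conjugate_periods (δ := weight B A (factor s 0 r)) (ρ := r) hFn
    (by positivity) hp'0 ?_ (fun c => hwF [c]) ?_⟩
  · intro c
    refine (Nat.gcd_dvd_right _ _).trans ?_
    fin_cases c
    · exact Nat.gcd_dvd_left _ _
    · exact Nat.gcd_dvd_right _ _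
  · intro c j hj hmod
    rw [← hF] at hj ⊢
    obtain ⟨e, he⟩ := Nat.modEq_iff_dvd.1 hmod
    have hrj : (r : ZMod p) - j ∈ H := by
      have h1 : (r : ZMod p) - j = e • ((p' : ℤ) : ZMod p) := by
        rw [zsmul_eq_mul, mul_comm, ← Int.cast_mul, ← he]
        push_cast
        rfl
      rw [h1]
      exact H.zsmul_mem hp'H e
    -- Some block of the letter `c` starts at residue `r - j` modulo `p`, so its place `j` falls on
    -- a period boundary of `s`.
    obtain ⟨i, hi, hsi, hφi⟩ := hres c _ hrj
    have h1 := hFfix.factor_add hFm i (j := j) (by rw [hsi]; exact hj)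
    -- Since `i ≥ 1`, the block of the first letter comes before and alone exceeds the preperiod.
    have hge : r ≤ (F (factor s 0 i)).length + j := by
      have h2 : r < (F [0]).length := lt_of_le_of_lt hNr ((Nat.lt_succ_self N).trans (hlen (N + 1)))
      obtain ⟨i, rfl⟩ := Nat.exists_eq_add_of_le hi
      rw [AbelianPeriodicity.factor_add, hFm, List.length_append]
      have h3 : factor s 0 1 = [0] := by simp [factor, hs, omegaWord_zero]
      rw [h3]
      omega
    have hmodp : r ≡ (F (factor s 0 i)).length + j [MOD p] := by
      rw [← ZMod.natCast_eq_natCast_iff]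
      push_cast
      rw [show ((F (factor s 0 i)).length : ZMod p) = r - j from hφi]
      ring
    obtain ⟨k, hk⟩ := (Nat.modEq_iff_dvd' hge).1 hmodp
    have h2 := weight_factor_of_abelianPeriodic h hper k
    rw [show r + k * p = (F (factor s 0 i)).length + j by rw [mul_comm] at hk; omega, h1,
      weight_append, hwF, zero_add, hsi] at h2
    exact h2

theorem abelianPeriodic_iff_of_det_eq_zero (hf : IsMorphism f) (hn : IsNonerasing f)
    (hp : IsProlongable f 0) (hprim : IsPrimitive f)
    (hdet : ((f [0]).count 0 : ℤ) * (f [1]).count 1 - (f [1]).count 0 * (f [0]).count 1 = 0) :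
    IsEventuallyAbelianPeriodic (omegaWord f 0) ↔
      ∃ (K : ℕ) (u v u' v' : List (Fin 2)), f^[K] [0] = u ++ v ∧ f^[K] [1] = u' ++ v' ∧
        AbelianEquiv u u' ∧ ∃ P P' : List (Fin 2), HasAbelianPeriod (v ++ u) P ∧
          HasAbelianPeriod (v' ++ u') P' ∧ AbelianEquiv P P' := by
  refine ⟨exists_conjugate_periods_of_abelianPeriodic hf hn hp hprim hdet, ?_⟩
  rintro ⟨K, u, v, u', v', h0, h1, huu, P, P', hP, hP', hPP⟩
  exact abelianPeriodic_of_conjugate_periods (hf.iterate K) (hn.iterate hf K)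
    ((fixes_omegaWord hf hn hp).iterate K) h0 h1 huu hP hP' hPP

end Rank

end AbelianPeriodicity

/-- The two-letter alphabet is `Fin 2`, with `a = 0` and `b = 1`. -/
theorem theorem1 (f : List (Fin 2) → List (Fin 2))
    (hf : AbelianPeriodicity.IsMorphism f)
    (hnonerasing : AbelianPeriodicity.IsNonerasing f)
    (hprolongable : AbelianPeriodicity.IsProlongable f 0)
    (θ₁ θ₂ : ℂ)
    (hθ : AbelianPeriodicity.AreOrderedEigenvalues
      (AbelianPeriodicity.morphismMatrix f) θ₁ θ₂) :
    (AbelianPeriodicity.IsPrimitive f → θ₂ ≠ 0 →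
      (AbelianPeriodicity.IsEventuallyAbelianPeriodic (AbelianPeriodicity.omegaWord f 0) ↔
        ∃ k m : ℕ,
          f [0] = [0] ++ AbelianPeriodicity.wordPow [1, 0] k ∧
          f [1] = [1] ++ AbelianPeriodicity.wordPow [0, 1] m)) ∧
    (AbelianPeriodicity.IsPrimitive f → θ₂ = 0 →
      (AbelianPeriodicity.IsEventuallyAbelianPeriodic (AbelianPeriodicity.omegaWord f 0) ↔
        ∃ (K : ℕ) (u v u' v' : List (Fin 2)),
          f^[K] [0] = u ++ v ∧
          f^[K] [1] = u' ++ v' ∧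
          AbelianPeriodicity.AbelianEquiv u u' ∧
          ∃ P P' : List (Fin 2),
            AbelianPeriodicity.HasAbelianPeriod (v ++ u) P ∧
            AbelianPeriodicity.HasAbelianPeriod (v' ++ u') P' ∧
            AbelianPeriodicity.AbelianEquiv P P')) ∧
    (¬ AbelianPeriodicity.IsPrimitive f →
      (AbelianPeriodicity.IsEventuallyAbelianPeriodic (AbelianPeriodicity.omegaWord f 0) ↔
        AbelianPeriodicity.IsEventuallyPeriodic (AbelianPeriodicity.omegaWord f 0))) := by
  have hd := AbelianPeriodicity.det_eq_mul hθ
  refine ⟨fun hprim h2 => ?_, fun hprim h2 => ?_, fun hprim => ?_⟩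
  · refine AbelianPeriodicity.abelianPeriodic_iff_of_det_ne_zero hf hnonerasing hprolongable
      hprim fun h0 => ?_
    -- The ordering of the eigenvalues makes `θ₂ ≠ 0` equivalent to a nonzero determinant.
    have h1 : θ₁ ≠ 0 := by
      rintro rfl
      exact h2 (by simpa using hθ.2)
    refine mul_ne_zero h1 h2 ?_
    rw [← hd]
    exact_mod_cast h0
  · refine AbelianPeriodicity.abelianPeriodic_iff_of_det_eq_zero hf hnonerasing hprolongable
      hprim ?_
    rw [h2, mul_zero] at hd
    exact_mod_cast hd
  · exact AbelianPeriodicity.abelianPeriodic_iff_of_not_primitive hf hnonerasing hprolongable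
      hprim
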